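/- Let $p$ be a prime, $k$ a finite field of characteristic $p$, $n=[k:\mathbb F_p]$, $\bar{\mathbb F}_p$ an algebraic closure of $\mathbb F_p$ and $K=\bar{\mathbb F}_p((u))$. Let $\phi$ be the ring endomorphism of $(\bar{\mathbb F}_p\otimes_{\mathbb F_p}k)((u))$ which is the identity on $\bar{\mathbb F}_p$, the $p$-power map on $k$ and sends $u$ to $u^p$; write $\phi$ also for the endomorphism of $K$ which is the identity on $\bar{\mathbb F}_p$ and sends $u$ to $u^p$. Let $A\in \mathrm{GL}_2\big((\bar{\mathbb F}_p\otimes_{\mathbb F_p}k)((u))\big)$, $N=\big((\bar{\mathbb F}_p\otimes_{\mathbb F_p} k)((u))\big)^2$ and $\Phi_A\colon N\to N$, $\Phi_A(v)=A\,\phi(v)$. Assume that $(N,\Phi_A)$ is simple, i.e. the only $\Phi_A$-stable $(\bar{\mathbb F}_p\otimes_{\mathbb F_p} k)((u))$-submodules of $N$ are $0$ and $N$. Number the embeddings $\sigma_i\colon k\to\bar{\mathbb F}_p$, $i\in\mathbb Z/n\mathbb Z$, so that $\sigma_{i-1}=\sigma_i\circ(x\mapsto x^p)$. The maps $x\otimes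 y\mapsto x\,\sigma_i(y)$ decompose $N$ as $N_1\times\dots\times N_n$ with $N_i=K^2$, and $\Phi_A$ into the $\phi$-semilinear maps $\Phi_{i-1}\colon N_{i-1}\to N_i$, $v\mapsto A_i\,\phi(v)$, where $A_i\in\mathrm{GL}_2(K)$ is the $i$-th component of $A$ (indices modulo $n$). Let $\bar{\mathcal B}_i$ be the (geometric realization of the) Bruhat–Tits tree of $\mathrm{PGL}_2(K)$ attached to $N_i$: its points are the homothety classes of splittable non-archimedean norms on $N_i$ (norms $\eta$ for which there is a basis $b_1,b_2$ with $\eta(x_1b_1+x_2b_2)=\max_j|x_j|\,\eta(b_j)$); its vertices are the classes $\bar{\mathfrak M}_i$ of the norms with unit ball an $\bar{\mathbb F}_p[[u]]$-lattice $\mathfrak M_i\subset N_i$, i.e. the homothety classes of lattices; and it carries the metric $d$ for which adjacent vertices have distance $1$. Write $[x,y]=\{z: d(x,z)+d(z,y)=d(x,y)\}$ for the geodesic between two points. Let $\bar\Phi_{i-1}\colon\bar{\mathcal B}_{i-1}\to\bar{\mathcal B}_i$ be the map that sends the class of $\eta$ to the class of the norm $w\mapsto\inf\max_j|c_j|\,\eta(v_j)^p$,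 the infimum being over all finite expressions $w=\sum_j c_j\Phi_{i-1}(v_j)$ with $c_j\in K$, $v_j\in N_{i-1}$; it extends the map $\bar{\mathfrak M}_{i-1}\mapsto[\Phi_{i-1}(\phi^*\mathfrak M_{i-1})]$ on homothety classes of lattices, where $\Phi_{i-1}(\phi^*\mathfrak M_{i-1})$ is the lattice generated by $\Phi_{i-1}(\mathfrak M_{i-1})$. Let $\bar\Phi_A$ be the self-map of $\bar{\mathcal B}=\bar{\mathcal B}_1\times\dots\times\bar{\mathcal B}_n$ whose $i$-th component is $(x_1,\dots,x_n)\mapsto\bar\Phi_{i-1}(x_{i-1})$. Then: (i) there is a unique point $P=(P_1,\dots,P_n)\in\bar{\mathcal B}$ with $\bar\Phi_A(P)=P$; (ii) for every $i$, the point $P_i$ is not a vertex of $\bar{\mathcal B}_i$; (iii) for every tuple $\mathfrak M=(\mathfrak M_1,\dots,\mathfrak M_n)$ of $\bar{\mathbb F}_p[[u]]$-lattices $\mathfrak M_i\subset N_i$ there is an index $i\in\{1,\dots,n\}$ with $P_i\in[\bar{\mathfrak M}_i,\bar\Phi_{i-1}(\bar{\mathfrak M}_{i-1})]$. -/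

import Mathlib

open scoped LaurentSeries PowerSeries TensorProduct

noncomputable section

namespace Kisin

/-! ### Laurent series: change of coefficients and `u ↦ u ^ p` -/

/-- The ring homomorphism `R((u)) → S((u))` which applies `f` to every coefficient. -/
def mapCoeff {R S : Type*} [CommRing R] [CommRing S] (f : R →+* S) : R⸨X⸩ →+* S⸨X⸩ where
  toFun x := x.map f
  map_one' := HahnSeries.map_one f.toMonoidWithZeroHom
  map_mul' _ _ := HahnSeries.map_mul (f : R →ₙ+* S)
  map_zero' := HahnSeries.map_zero (f : ZeroHom R S)
  map_add' _ _ := HahnSeries.map_add (f : R →+ S)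

/-- The ring homomorphism `R((u)) → R((u))`, `∑ aᵢ uⁱ ↦ ∑ aᵢ u ^ (p * i)`. -/
def expand (R : Type*) [CommRing R] (p : ℕ) [Fact p.Prime] : R⸨X⸩ →+* R⸨X⸩ :=
  HahnSeries.embDomainRingHom (AddMonoidHom.mulLeft (p : ℤ))
    (fun _ _ h => mul_left_cancel₀ (Nat.cast_ne_zero.2 (Fact.out : p.Prime).ne_zero) h)
    (fun _ _ => mul_le_mul_iff_right₀ (Nat.cast_pos.2 (Fact.out : p.Prime).pos))

theorem coeff_expand_mul {R : Type*} [CommRing R] (p : ℕ) [Fact p.Prime] (x : R⸨X⸩) (m : ℤ) :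
    (expand R p x).coeff ((p : ℤ) * m) = x.coeff m :=
  HahnSeries.embDomain_coeff (f := ⟨⟨AddMonoidHom.mulLeft (p : ℤ), _⟩, _⟩)

theorem coeff_expand_of_not {R : Type*} [CommRing R] (p : ℕ) [Fact p.Prime] (x : R⸨X⸩) {g : ℤ}
    (hg : ¬ ∃ m : ℤ, (p : ℤ) * m = g) : (expand R p x).coeff g = 0 :=
  HahnSeries.embDomain_of_notMem_range (f := ⟨⟨AddMonoidHom.mulLeft (p : ℤ), _⟩, _⟩)
    fun ⟨m, hm⟩ => hg ⟨m, hm⟩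

/-- For a matrix `B` over `R` and a ring endomorphism `τ`, the `τ`-semilinear map
`v ↦ B τ(v)` of `R²`. -/
def semilin {R : Type*} [CommRing R] (τ : R →+* R) (B : Matrix (Fin 2) (Fin 2) R) :
    (Fin 2 → R) →ₛₗ[τ] (Fin 2 → R) where
  toFun v := B.mulVec fun i => τ (v i)
  map_add' v w := by
    rw [← Matrix.mulVec_add]; congr 1; ext i; simp
  map_smul' c v := by
    rw [← Matrix.mulVec_smul]; congr 1; ext i; simp

/-! ### The `φ`-module `(N, Φ_A)` and its components -/

section PhiModule

variable (p : ℕ) [Fact p.Prime] (F k : Type*) [Field F] [Field k]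
  [Algebra (ZMod p) F] [Algebra (ZMod p) k]

/-- `φ` on `(F ⊗ k)((u))`: the identity on `F`, the `p`-power map on `k`, and `u ↦ u ^ p`. -/
def phi : (F ⊗[ZMod p] k)⸨X⸩ →+* (F ⊗[ZMod p] k)⸨X⸩ :=
  (expand (F ⊗[ZMod p] k) p).comp
    (mapCoeff (Algebra.TensorProduct.map (AlgHom.id (ZMod p) F)
      (FiniteField.frobeniusAlgHom (ZMod p) k)).toRingHom)

variable {p F k}

/-- `Φ_A = A φ` on `N = (F ⊗ k)((u))²`. -/
def PhiA (A : GL (Fin 2) (F ⊗[ZMod p] k)⸨X⸩) :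
    (Fin 2 → (F ⊗[ZMod p] k)⸨X⸩) →ₛₗ[phi p F k] (Fin 2 → (F ⊗[ZMod p] k)⸨X⸩) :=
  semilin (phi p F k) A.val

/-- `(N, Φ_A)` is simple: the only `Φ_A`-stable submodules of `N` are `0` and `N`. -/
def IsSimplePhi (A : GL (Fin 2) (F ⊗[ZMod p] k)⸨X⸩) : Prop :=
  ∀ W : Submodule (F ⊗[ZMod p] k)⸨X⸩ (Fin 2 → (F ⊗[ZMod p] k)⸨X⸩),
    (∀ v ∈ W, PhiA A v ∈ W) → W = ⊥ ∨ W = ⊤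

/-- The factors of `F ⊗ k` (for `k` finite and `F` algebraically closed) are indexed by the
embeddings `i : k → F`. The cyclic predecessor `i - 1` of `i` is `i` composed with the `p`-power
Frobenius of `k`. -/
def pred (i : k →ₐ[ZMod p] F) : k →ₐ[ZMod p] F :=
  i.comp (FiniteField.frobeniusAlgHom (ZMod p) k)

/-- The projection `(F ⊗ k)((u)) → F((u))` to the factor `i`, induced by `x ⊗ y ↦ x i(y)`. -/
def proj (i : k →ₐ[ZMod p] F) : (F ⊗[ZMod p] k)⸨X⸩ →+* F⸨X⸩ :=
  mapCoeff (Algebra.TensorProduct.lift (AlgHom.id (ZMod p) F) i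
    (fun _ _ => Commute.all _ _)).toRingHom

/-- The component `A_i ∈ GL₂(F((u)))` of `A`. -/
def comp (A : GL (Fin 2) (F ⊗[ZMod p] k)⸨X⸩) (i : k →ₐ[ZMod p] F) : GL (Fin 2) F⸨X⸩ :=
  Matrix.GeneralLinearGroup.map (proj i) A

/-- The component `v ↦ A_i φ(v)` of `Φ_A` from `N_{i-1} = F((u))²` to `N_i = F((u))²`. -/
def PhiComp (A : GL (Fin 2) (F ⊗[ZMod p] k)⸨X⸩) (i : k →ₐ[ZMod p] F) :
    (Fin 2 → F⸨X⸩) →ₛₗ[expand F p] (Fin 2 → F⸨X⸩) :=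
  semilin (expand F p) (comp A i).val

theorem proj_phi (i : k →ₐ[ZMod p] F) (x : (F ⊗[ZMod p] k)⸨X⸩) :
    proj i (phi p F k x) = expand F p (proj (pred i) x) := by
  have key : ∀ z : F ⊗[ZMod p] k,
      Algebra.TensorProduct.lift (AlgHom.id (ZMod p) F) i (fun _ _ => Commute.all _ _)
        (Algebra.TensorProduct.map (AlgHom.id (ZMod p) F)
          (FiniteField.frobeniusAlgHom (ZMod p) k) z) =
      Algebra.TensorProduct.lift (AlgHom.id (ZMod p) F) (pred i) (fun _ _ => Commute.all _ _) z := by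
    intro z
    induction z with
    | zero => simp
    | add x y hx hy => simp only [map_add, hx, hy]
    | tmul x y =>
      rw [Algebra.TensorProduct.map_tmul, Algebra.TensorProduct.lift_tmul,
        Algebra.TensorProduct.lift_tmul]
      simp [pred]
  ext g
  by_cases hg : ∃ m : ℤ, (p : ℤ) * m = g
  · obtain ⟨m, rfl⟩ := hg
    exact (congrArg (Algebra.TensorProduct.lift (AlgHom.id (ZMod p) F) i
      (fun _ _ => Commute.all _ _)) (coeff_expand_mul p _ m)).trans
      ((key _).trans (coeff_expand_mul p (proj (pred i) x) m).symm)
  · rw [coeff_expand_of_not p _ hg]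
    exact (congrArg (Algebra.TensorProduct.lift (AlgHom.id (ZMod p) F) i
      (fun _ _ => Commute.all _ _)) (coeff_expand_of_not p _ hg)).trans (map_zero _)

/-- `Φ_A` splits into the maps `PhiComp A i`. -/
theorem proj_PhiA (A : GL (Fin 2) (F ⊗[ZMod p] k)⸨X⸩) (i : k →ₐ[ZMod p] F)
    (v : Fin 2 → (F ⊗[ZMod p] k)⸨X⸩) :
    (fun j => proj i (PhiA A v j)) = PhiComp A i (fun j => proj (pred i) (v j)) := by
  ext1 j
  fin_cases j <;> simp [PhiA, PhiComp, semilin, comp, proj_phi]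

end PhiModule

/-! ### The tree of `PGL₂(F((u)))`

Points are homothety classes of splittable ultrametric norms on `F((u))²`. -/

section Tree

variable {F : Type*} [Field F]

open Classical in
/-- The absolute value on `F((u))` with `|u| = e⁻¹`. -/
def absK (x : F⸨X⸩) : ℝ := if x = 0 then 0 else Real.exp (-(x.order : ℝ))

theorem absK_zero : absK (0 : F⸨X⸩) = 0 := if_pos rfl

theorem absK_of_ne {x : F⸨X⸩} (hx : x ≠ 0) : absK x = Real.exp (-(x.order : ℝ)) := if_neg hx

theorem absK_nonneg (x : F⸨X⸩) : 0 ≤ absK x := by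
  unfold absK; split_ifs <;> positivity

theorem absK_eq_zero {x : F⸨X⸩} : absK x = 0 ↔ x = 0 := by
  unfold absK; split_ifs with h <;> simp [h, Real.exp_ne_zero]

theorem absK_one : absK (1 : F⸨X⸩) = 1 := by
  rw [absK_of_ne one_ne_zero]; simp

theorem absK_mul (x y : F⸨X⸩) : absK (x * y) = absK x * absK y := by
  by_cases hx : x = 0
  · simp [hx, absK_zero]
  by_cases hy : y = 0
  · simp [hy, absK_zero]
  rw [absK_of_ne hx, absK_of_ne hy, absK_of_ne (mul_ne_zero hx hy), HahnSeries.order_mul hx hy,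
    ← Real.exp_add]
  push_cast; ring_nf

theorem absK_add (x y : F⸨X⸩) : absK (x + y) ≤ max (absK x) (absK y) := by
  by_cases hx : x = 0
  · simp [hx]
  by_cases hy : y = 0
  · simp [hy]
  by_cases h : x + y = 0
  · rw [h, absK_zero]; exact le_max_of_le_left (absK_nonneg x)
  rw [absK_of_ne hx, absK_of_ne hy, absK_of_ne h]
  have := HahnSeries.min_order_le_order_add h
  rcases min_le_iff.1 this with h | h
  · exact le_max_of_le_left (by gcongr)
  · exact le_max_of_le_right (by gcongr)

theorem absK_expand (p : ℕ) [Fact p.Prime] (x : F⸨X⸩) : absK (expand F p x) = absK x ^ p := by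
  by_cases hx : x = 0
  · simp [hx, absK_zero, (Fact.out : p.Prime).ne_zero]
  have hx' : expand F p x ≠ 0 := (map_ne_zero _).2 hx
  have ho : (expand F p x).order = p * x.order := by
    refine le_antisymm (HahnSeries.order_le_of_coeff_ne_zero ?_) ?_
    · rw [coeff_expand_mul]; exact fun h => hx (HahnSeries.coeff_order_eq_zero.1 h)
    · have h : (expand F p x).coeff (expand F p x).order ≠ 0 :=
        fun h => hx' (HahnSeries.coeff_order_eq_zero.1 h)
      obtain ⟨m, hm⟩ : ∃ m : ℤ, (p : ℤ) * m = (expand F p x).order := by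
        by_contra hc; exact h (coeff_expand_of_not p x hc)
      rw [← hm, coeff_expand_mul] at h
      rw [← hm]
      exact mul_le_mul_of_nonneg_left (HahnSeries.order_le_of_coeff_ne_zero h) (Nat.cast_nonneg p)
  rw [absK_of_ne hx, absK_of_ne hx', ho, ← Real.exp_nat_mul]
  push_cast; ring_nf

/-- A splittable norm on `F((u))²`. -/
structure SplitNorm (F : Type*) [Field F] where
  /-- the underlying function -/
  toFun : (Fin 2 → F⸨X⸩) → ℝ
  eq_zero_iff : ∀ v, toFun v = 0 ↔ v = 0
  map_smul : ∀ (c : F⸨X⸩) v, toFun (c • v) = absK c * toFun v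
  add_le : ∀ v w, toFun (v + w) ≤ max (toFun v) (toFun w)
  exists_splitting : ∃ b : Module.Basis (Fin 2) F⸨X⸩ (Fin 2 → F⸨X⸩), ∀ v,
    toFun v = max (absK (b.repr v 0) * toFun (b 0)) (absK (b.repr v 1) * toFun (b 1))

namespace SplitNorm

theorem zero (η : SplitNorm F) : η.toFun 0 = 0 := (η.eq_zero_iff 0).2 rfl

theorem nonneg (η : SplitNorm F) (v) : 0 ≤ η.toFun v := by
  have h1 : absK (-1 : F⸨X⸩) = 1 := by
    rw [absK_of_ne (neg_ne_zero.2 one_ne_zero), HahnSeries.order_neg]; simp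
  have h := η.add_le v ((-1 : F⸨X⸩) • v)
  rw [η.map_smul, h1] at h
  simpa [η.zero] using h

theorem pos (η : SplitNorm F) {v} (hv : v ≠ 0) : 0 < η.toFun v :=
  lt_of_le_of_ne (η.nonneg v) fun h => hv ((η.eq_zero_iff v).1 h.symm)

theorem ext {η θ : SplitNorm F} (h : ∀ v, η.toFun v = θ.toFun v) : η = θ := by
  cases η; cases θ; simp only [mk.injEq]; exact funext h

theorem sum_le (η : SplitNorm F) {m : ℕ} (v : Fin m → Fin 2 → F⸨X⸩) {r : ℝ} (hr : 0 ≤ r)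
    (h : ∀ j, η.toFun (v j) ≤ r) : η.toFun (∑ j, v j) ≤ r := by
  refine Finset.sum_induction v (fun x => η.toFun x ≤ r) (fun x y hx hy => ?_) ?_ fun j _ => h j
  · exact (η.add_le x y).trans (max_le hx hy)
  · rwa [η.zero]

/-- The norm `∑ xᵢ bᵢ ↦ max |xᵢ| aᵢ` attached to a basis `b` and positive reals `a`. -/
def ofBasis (b : Module.Basis (Fin 2) F⸨X⸩ (Fin 2 → F⸨X⸩)) (a : Fin 2 → ℝ) (ha : ∀ i, 0 < a i) :
    SplitNorm F where
  toFun v := max (absK (b.repr v 0) * a 0) (absK (b.repr v 1) * a 1)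
  eq_zero_iff v := by
    constructor
    · intro h
      have h0 := le_max_left (absK (b.repr v 0) * a 0) (absK (b.repr v 1) * a 1)
      have h1 := le_max_right (absK (b.repr v 0) * a 0) (absK (b.repr v 1) * a 1)
      rw [h] at h0 h1
      have key : ∀ i, absK (b.repr v i) * a i ≤ 0 → b.repr v i = 0 := fun i hi => by
        have : absK (b.repr v i) ≤ 0 := by
          by_contra hc
          exact absurd (mul_pos (not_le.1 hc) (ha i)) (not_lt.2 hi)
        exact absK_eq_zero.1 (le_antisymm this (absK_nonneg _))
      refine b.repr.map_eq_zero_iff.1 (Finsupp.ext fun i => ?_)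
      fin_cases i
      · exact key 0 h0
      · exact key 1 h1
    · rintro rfl; simp [absK_zero]
  map_smul c v := by
    simp only [_root_.map_smul, Finsupp.smul_apply, smul_eq_mul, absK_mul, mul_assoc]
    rw [mul_max_of_nonneg _ _ (absK_nonneg c)]
  add_le v w := by
    have key : ∀ i, absK (b.repr (v + w) i) * a i ≤
        max (absK (b.repr v i) * a i) (absK (b.repr w i) * a i) := fun i => by
      rw [← max_mul_of_nonneg _ _ (ha i).le]
      simp only [map_add, Finsupp.add_apply]
      exact mul_le_mul_of_nonneg_right (absK_add _ _) (ha i).le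
    refine max_le ((key 0).trans ?_) ((key 1).trans ?_)
    · exact max_le_max (le_max_left _ _) (le_max_left _ _)
    · exact max_le_max (le_max_right _ _) (le_max_right _ _)
  exists_splitting := by
    refine ⟨b, fun v => ?_⟩
    simp [absK_zero, absK_one, (ha 0).le, (ha 1).le]

end SplitNorm

/-- Two norms are homothetic if they differ by a positive constant. -/
instance homothety (F : Type*) [Field F] : Setoid (SplitNorm F) where
  r η θ := ∃ c : ℝ, 0 < c ∧ ∀ v, θ.toFun v = c * η.toFun v
  iseqv :=
    { refl := fun _ => ⟨1, one_pos, fun _ => (one_mul _).symm⟩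
      symm := fun ⟨c, hc, h⟩ => ⟨c⁻¹, inv_pos.2 hc, fun v => by
        rw [h v, inv_mul_cancel_left₀ hc.ne']⟩
      trans := fun ⟨c, hc, h⟩ ⟨d, hd, h'⟩ => ⟨d * c, mul_pos hd hc, fun v => by
        rw [h' v, h v, mul_assoc]⟩ }

/-- The (geometric realisation of the) Bruhat–Tits tree of `PGL₂(F((u)))`. -/
def Tree (F : Type*) [Field F] : Type _ := Quotient (homothety F)

/-- The metric on the tree: `log sup (θ / η) + log sup (η / θ)`. Two classes which are split by a
common basis, with values `exp (-αᵢ)` and `exp (-βᵢ)` on it, have distance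
`|(α₀ - α₁) - (β₀ - β₁)|`; neighbouring vertices have distance `1`. -/
def Tree.dist : Tree F → Tree F → ℝ :=
  Quotient.lift₂
    (fun η θ => Real.log ((⨆ v, θ.toFun v / η.toFun v) * ⨆ v, η.toFun v / θ.toFun v)) (by
      rintro η θ η' θ' ⟨c, hc, h⟩ ⟨d, hd, h'⟩
      have e1 : (⨆ v, θ'.toFun v / η'.toFun v) = d / c * ⨆ v, θ.toFun v / η.toFun v := by
        rw [Real.mul_iSup_of_nonneg (by positivity)]
        exact iSup_congr fun v => by rw [h, h', mul_div_mul_comm]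
      have e2 : (⨆ v, η'.toFun v / θ'.toFun v) = c / d * ⨆ v, η.toFun v / θ.toFun v := by
        rw [Real.mul_iSup_of_nonneg (by positivity)]
        exact iSup_congr fun v => by rw [h, h', mul_div_mul_comm]
      simp only [e1, e2]
      congr 1
      field_simp)

/-- The geodesic `[x, y]`. -/
def Tree.geodesic (x y : Tree F) : Set (Tree F) :=
  {z | x.dist z + z.dist y = x.dist y}

/-- The `F[[u]]`-lattices in `F((u))²`. -/
structure Lattice (F : Type*) [Field F] where
  /-- the underlying submodule -/
  carrier : Submodule F⟦X⟧ (Fin 2 → F⸨X⸩)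
  isLattice : carrier.IsLattice F⸨X⸩

/-- The norm with unit ball `M`: `v ↦ inf {|c| : v ∈ c M}`. -/
def latticeFun (M : Submodule F⟦X⟧ (Fin 2 → F⸨X⸩)) (v : Fin 2 → F⸨X⸩) : ℝ :=
  sInf {r | ∃ c : F⸨X⸩, ∃ m ∈ M, v = c • m ∧ r = absK c}

theorem absK_powerSeries (f : F⟦X⟧) : absK (algebraMap F⟦X⟧ F⸨X⸩ f) ≤ 1 := by
  by_cases h0 : algebraMap F⟦X⟧ F⸨X⸩ f = 0
  · simp [h0, absK_zero]
  rw [absK_of_ne h0, Real.exp_le_one_iff, neg_nonpos]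
  have : (algebraMap F⟦X⟧ F⸨X⸩ f).coeff (algebraMap F⟦X⟧ F⸨X⸩ f).order ≠ 0 :=
    fun h => h0 (HahnSeries.coeff_order_eq_zero.1 h)
  by_contra hc
  have hc' : (algebraMap F⟦X⟧ F⸨X⸩ f).order < 0 := by
    rw [not_le] at hc; exact_mod_cast hc
  refine this ?_
  have h := PowerSeries.coeff_coe f (algebraMap F⟦X⟧ F⸨X⸩ f).order
  rw [if_pos hc'] at h
  exact h

theorem exists_powerSeries {x : F⸨X⸩} (hx : absK x ≤ 1) : ∃ f : F⟦X⟧, algebraMap F⟦X⟧ F⸨X⸩ f = x := by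
  by_cases h0 : x = 0
  · exact ⟨0, by simp [h0]⟩
  rw [absK_of_ne h0, Real.exp_le_one_iff, neg_nonpos] at hx
  have hx' : 0 ≤ x.order := by exact_mod_cast hx
  exact ⟨_, LaurentSeries.X_order_mul_powerSeriesPart (n := x.order.toNat) (Int.toNat_of_nonneg hx')⟩

/-- A basis of the lattice `M` splits its norm. -/
theorem latticeFun_eq (M : Submodule F⟦X⟧ (Fin 2 → F⸨X⸩))
    (b : Module.Basis (Fin 2) F⸨X⸩ (Fin 2 → F⸨X⸩))
    (hb : M = Submodule.span F⟦X⟧ (Set.range b)) (v) :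
    latticeFun M v = (SplitNorm.ofBasis b 1 fun _ => one_pos).toFun v := by
  have hval : ∀ w, (SplitNorm.ofBasis b 1 fun _ => one_pos).toFun w =
      max (absK (b.repr w 0)) (absK (b.repr w 1)) := fun w => by simp [SplitNorm.ofBasis]
  have hM : ∀ m, m ∈ M ↔ (SplitNorm.ofBasis b 1 fun _ => one_pos).toFun m ≤ 1 := by
    intro m
    rw [hval, hb, Submodule.mem_span_range_iff_exists_fun]
    constructor
    · rintro ⟨c, rfl⟩
      have : ∀ i, b.repr (∑ j, c j • b j) i = algebraMap F⟦X⟧ F⸨X⸩ (c i) := fun i => by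
        simp only [← IsScalarTower.algebraMap_smul F⸨X⸩ (c _)]
        exact congrFun (b.repr_sum_self _) i
      rw [this, this]
      exact max_le (absK_powerSeries _) (absK_powerSeries _)
    · intro h
      obtain ⟨f, hf⟩ := exists_powerSeries ((le_max_left _ _).trans h)
      obtain ⟨g, hg⟩ := exists_powerSeries ((le_max_right _ _).trans h)
      refine ⟨![f, g], ?_⟩
      simp only [← IsScalarTower.algebraMap_smul F⸨X⸩ (_ : F⟦X⟧), Fin.sum_univ_two]
      conv_rhs => rw [← b.sum_repr m, Fin.sum_univ_two, ← hf, ← hg]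
      rfl
  have hmem : (SplitNorm.ofBasis b 1 fun _ => one_pos).toFun v ∈
      {r | ∃ c : F⸨X⸩, ∃ m ∈ M, v = c • m ∧ r = absK c} := by
    have key : ∃ c : F⸨X⸩, absK c = (SplitNorm.ofBasis b 1 fun _ => one_pos).toFun v := by
      rw [hval]
      rcases max_choice (absK (b.repr v 0)) (absK (b.repr v 1)) with h | h <;> exact ⟨_, h.symm⟩
    obtain ⟨c, hc⟩ := key
    rw [← hc]
    by_cases h0 : v = 0
    · refine ⟨c, 0, M.zero_mem, by simp [h0], rfl⟩
    have hc0 : c ≠ 0 := fun h => h0 ((SplitNorm.eq_zero_iff _ _).1 (by rw [← hc, h, absK_zero]))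
    refine ⟨c, c⁻¹ • v, (hM _).2 ?_, (smul_inv_smul₀ hc0 v).symm, rfl⟩
    rw [SplitNorm.map_smul, ← hc, ← absK_mul, inv_mul_cancel₀ hc0, absK_one]
  refine le_antisymm (csInf_le ⟨0, ?_⟩ hmem) (le_csInf ⟨_, hmem⟩ ?_)
  · rintro _ ⟨c, m, _, _, rfl⟩; exact absK_nonneg c
  rintro _ ⟨c, m, hm, rfl, rfl⟩
  rw [SplitNorm.map_smul]
  exact mul_le_of_le_one_right (absK_nonneg c) ((hM m).1 hm)

theorem Lattice.exists_basis (M : Lattice F) : ∃ b : Module.Basis (Fin 2) F⸨X⸩ (Fin 2 → F⸨X⸩),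
    M.carrier = Submodule.span F⟦X⟧ (Set.range b) := by
  have := M.isLattice
  let b := Module.finBasisOfFinrankEq F⟦X⟧ M.carrier
    ((Submodule.IsLattice.finrank_of_pi (K := F⸨X⸩) M.carrier).trans (Fintype.card_fin 2))
  refine ⟨b.extendOfIsLattice F⸨X⸩, ?_⟩
  have h : Set.range (b.extendOfIsLattice F⸨X⸩) = M.carrier.subtype '' Set.range b := by
    ext x; simp
  rw [h, Submodule.span_image, b.span_eq, Submodule.map_top, Submodule.range_subtype]

/-- The norm with unit ball the lattice `M`. -/
def Lattice.norm (M : Lattice F) : SplitNorm F where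
  toFun := latticeFun M.carrier
  eq_zero_iff := by
    obtain ⟨b, hb⟩ := M.exists_basis
    rw [funext (latticeFun_eq M.carrier b hb)]; exact SplitNorm.eq_zero_iff _
  map_smul := by
    obtain ⟨b, hb⟩ := M.exists_basis
    rw [funext (latticeFun_eq M.carrier b hb)]; exact SplitNorm.map_smul _
  add_le := by
    obtain ⟨b, hb⟩ := M.exists_basis
    rw [funext (latticeFun_eq M.carrier b hb)]; exact SplitNorm.add_le _
  exists_splitting := by
    obtain ⟨b, hb⟩ := M.exists_basis
    rw [funext (latticeFun_eq M.carrier b hb)]; exact SplitNorm.exists_splitting _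

/-- The point of the tree defined by the homothety class of a lattice. -/
def Lattice.toTree (M : Lattice F) : Tree F := Quotient.mk (homothety F) M.norm

/-- The vertices of the tree are the homothety classes of lattices. -/
def Tree.IsVertex (x : Tree F) : Prop := ∃ M : Lattice F, M.toTree = x

/-! ### The map induced on the tree -/

section Push

variable {p : ℕ} [Fact p.Prime]

/-- The norm induced by `η` on the target of a semilinear map `Φ` (with respect to `u ↦ u ^ p`):
`w ↦ inf max_j |c_j| η(v_j)^p` over all expressions `w = ∑ c_j Φ(v_j)`. -/
def pushFun (Φ : (Fin 2 → F⸨X⸩) →ₛₗ[expand F p] (Fin 2 → F⸨X⸩)) (η : SplitNorm F)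
    (w : Fin 2 → F⸨X⸩) : ℝ :=
  sInf {r | 0 ≤ r ∧ ∃ (m : ℕ) (c : Fin m → F⸨X⸩) (v : Fin m → Fin 2 → F⸨X⸩),
    w = ∑ j, c j • Φ (v j) ∧ ∀ j, absK (c j) * η.toFun (v j) ^ p ≤ r}

/-- If `b` splits `η` and `b'` is the basis `Φ(b)`, then `b'` splits the induced norm. -/
theorem pushFun_eq (Φ : (Fin 2 → F⸨X⸩) →ₛₗ[expand F p] (Fin 2 → F⸨X⸩)) (η : SplitNorm F)
    (b b' : Module.Basis (Fin 2) F⸨X⸩ (Fin 2 → F⸨X⸩)) (hb' : ∀ i, b' i = Φ (b i))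
    (hb : ∀ v, η.toFun v =
      max (absK (b.repr v 0) * η.toFun (b 0)) (absK (b.repr v 1) * η.toFun (b 1))) (w) :
    pushFun Φ η w = (SplitNorm.ofBasis b' (fun i => η.toFun (b i) ^ p)
      fun i => pow_pos (η.pos (b.ne_zero i)) p).toFun w := by
  set θ := SplitNorm.ofBasis b' (fun i => η.toFun (b i) ^ p)
    fun i => pow_pos (η.pos (b.ne_zero i)) p with hθ
  have hval : ∀ w, θ.toFun w = max (absK (b'.repr w 0) * η.toFun (b 0) ^ p)
      (absK (b'.repr w 1) * η.toFun (b 1) ^ p) := fun _ => rfl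
  have hΦ : ∀ v, θ.toFun (Φ v) = η.toFun v ^ p := by
    intro v
    have h : Φ v = ∑ i, expand F p (b.repr v i) • b' i := by
      conv_lhs => rw [← b.sum_repr v, map_sum]
      exact Finset.sum_congr rfl fun i _ => by rw [LinearMap.map_smulₛₗ, hb']
    have hr : ∀ i, b'.repr (Φ v) i = expand F p (b.repr v i) := fun i => by
      rw [h]; exact congrFun (b'.repr_sum_self _) i
    rw [hval, hr, hr, absK_expand, absK_expand, ← mul_pow, ← mul_pow, hb v]
    have h0 := mul_nonneg (absK_nonneg (b.repr v 0)) (η.nonneg (b 0))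
    have h1 := mul_nonneg (absK_nonneg (b.repr v 1)) (η.nonneg (b 1))
    rcases le_total (absK (b.repr v 0) * η.toFun (b 0)) (absK (b.repr v 1) * η.toFun (b 1))
      with h | h
    · rw [max_eq_right h, max_eq_right (pow_le_pow_left₀ h0 h p)]
    · rw [max_eq_left h, max_eq_left (pow_le_pow_left₀ h1 h p)]
  have hmem : 0 ≤ θ.toFun w ∧ ∃ (m : ℕ) (c : Fin m → F⸨X⸩) (v : Fin m → Fin 2 → F⸨X⸩),
      w = ∑ j, c j • Φ (v j) ∧ ∀ j, absK (c j) * η.toFun (v j) ^ p ≤ θ.toFun w := by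
    refine ⟨θ.nonneg w, 2, fun j => b'.repr w j, fun j => b j, ?_, fun j => ?_⟩
    · conv_lhs => rw [← b'.sum_repr w]
      exact Finset.sum_congr rfl fun i _ => by rw [hb']
    · fin_cases j
      · exact le_max_left _ _
      · exact le_max_right _ _
  refine le_antisymm (csInf_le ⟨0, fun r hr => hr.1⟩ hmem) (le_csInf ⟨_, hmem⟩ ?_)
  rintro r ⟨hr, m, c, v, rfl, h⟩
  refine θ.sum_le _ hr fun j => ?_
  rw [θ.map_smul, hΦ]
  exact h j

/-- `v ↦ B φ(v)` takes bases to bases. -/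
theorem exists_basis_semilin (B : GL (Fin 2) F⸨X⸩)
    (b : Module.Basis (Fin 2) F⸨X⸩ (Fin 2 → F⸨X⸩)) :
    ∃ b' : Module.Basis (Fin 2) F⸨X⸩ (Fin 2 → F⸨X⸩), ∀ i, b' i = semilin (expand F p) B.val (b i) := by
  have h1 : IsUnit (Matrix.of fun i j => b j i : Matrix (Fin 2) (Fin 2) F⸨X⸩) :=
    Matrix.linearIndependent_cols_iff_isUnit.1 b.linearIndependent
  have h2 : IsUnit (B.val * (Matrix.of fun i j => b j i).map (expand F p)) :=
    B.isUnit.mul (h1.map (expand F p).mapMatrix)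
  have h3 : LinearIndependent F⸨X⸩ fun i => semilin (expand F p) B.val (b i) := by
    exact Matrix.linearIndependent_cols_iff_isUnit.2 h2
  refine ⟨basisOfLinearIndependentOfCardEqFinrank h3 (by simp), fun i => ?_⟩
  simp

theorem pushFun_ofBasis (B : GL (Fin 2) F⸨X⸩) (η : SplitNorm F) :
    ∃ θ : SplitNorm F, pushFun (semilin (expand F p) B.val) η = θ.toFun := by
  obtain ⟨b, hb⟩ := η.exists_splitting
  obtain ⟨b', hb'⟩ := exists_basis_semilin (p := p) B b
  exact ⟨_, funext (pushFun_eq _ η b b' hb' hb)⟩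

/-- The induced norm. -/
def push (p : ℕ) [Fact p.Prime] (B : GL (Fin 2) F⸨X⸩) (η : SplitNorm F) : SplitNorm F where
  toFun := pushFun (semilin (expand F p) B.val) η
  eq_zero_iff := by
    obtain ⟨θ, h⟩ := pushFun_ofBasis (p := p) B η
    rw [h]; exact θ.eq_zero_iff
  map_smul := by
    obtain ⟨θ, h⟩ := pushFun_ofBasis (p := p) B η
    rw [h]; exact θ.map_smul
  add_le := by
    obtain ⟨θ, h⟩ := pushFun_ofBasis (p := p) B η
    rw [h]; exact θ.add_le
  exists_splitting := by
    obtain ⟨θ, h⟩ := pushFun_ofBasis (p := p) B η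
    rw [h]; exact θ.exists_splitting

/-- The map of trees induced by `v ↦ B φ(v)`. -/
def treeMap (p : ℕ) [Fact p.Prime] (B : GL (Fin 2) F⸨X⸩) : Tree F → Tree F :=
  Quotient.map' (s₁ := homothety F) (s₂ := homothety F) (push p B) (by
    rintro η θ ⟨c, hc, h⟩
    refine ⟨c ^ p, pow_pos hc p, fun w => ?_⟩
    obtain ⟨b, hb⟩ := η.exists_splitting
    obtain ⟨b', hb'⟩ := exists_basis_semilin (p := p) B b
    have hbθ : ∀ v, θ.toFun v =
        max (absK (b.repr v 0) * θ.toFun (b 0)) (absK (b.repr v 1) * θ.toFun (b 1)) := fun v => by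
      rw [h, h, h, hb v, mul_max_of_nonneg _ _ hc.le]
      congr 1 <;> ring
    change pushFun _ θ w = c ^ p * pushFun _ η w
    rw [pushFun_eq _ η b b' hb' hb, pushFun_eq _ θ b b' hb' hbθ]
    simp only [SplitNorm.ofBasis, h]
    rw [mul_max_of_nonneg _ _ (pow_pos hc p).le]
    congr 1 <;> ring)

/-- The map of trees extends `[M] ↦ [Φ(φ^* M)]` on homothety classes of lattices. -/
theorem treeMap_toTree (B : GL (Fin 2) F⸨X⸩) (M : Lattice F) :
    ∃ M' : Lattice F, M'.carrier = Submodule.span F⟦X⟧ (semilin (expand F p) B.val '' M.carrier) ∧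
      treeMap p B M.toTree = M'.toTree := by
  obtain ⟨b, hb⟩ := M.exists_basis
  obtain ⟨b', hb'⟩ := exists_basis_semilin (p := p) B b
  have hspan : Submodule.span F⟦X⟧ (semilin (expand F p) B.val '' M.carrier) =
      Submodule.span F⟦X⟧ (Set.range b') := by
    refine le_antisymm (Submodule.span_le.2 ?_) (Submodule.span_le.2 ?_)
    · rintro _ ⟨m, hm, rfl⟩
      rw [hb] at hm
      obtain ⟨f, rfl⟩ := (Submodule.mem_span_range_iff_exists_fun _).1 hm
      rw [map_sum]
      refine Submodule.sum_mem _ fun i _ => ?_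
      obtain ⟨g, hg⟩ := exists_powerSeries (x := expand F p (algebraMap F⟦X⟧ F⸨X⸩ (f i))) (by
        rw [absK_expand]; exact pow_le_one₀ (absK_nonneg _) (absK_powerSeries _))
      rw [← IsScalarTower.algebraMap_smul F⸨X⸩ (f i), LinearMap.map_smulₛₗ, ← hb', ← hg,
        IsScalarTower.algebraMap_smul]
      exact Submodule.smul_mem _ _ (Submodule.subset_span ⟨i, rfl⟩)
    · rintro _ ⟨i, rfl⟩
      refine Submodule.subset_span ⟨b i, ?_, (hb' i).symm⟩
      rw [hb]; exact Submodule.subset_span ⟨i, rfl⟩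
  refine ⟨⟨Submodule.span F⟦X⟧ (Set.range b'), Submodule.fg_span (Set.finite_range _), by
    rw [Submodule.span_span_of_tower, b'.span_eq]⟩, hspan.symm, Quotient.sound ⟨1, one_pos, fun v => ?_⟩⟩
  obtain ⟨c, hc⟩ : ∃ c : Fin 2 → ℝ, c = fun i => M.norm.toFun (b i) ^ p := ⟨_, rfl⟩
  have h1 : ∀ i, M.norm.toFun (b i) = 1 := fun i => by
    refine (latticeFun_eq M.carrier b hb (b i)).trans ?_
    fin_cases i <;> simp [SplitNorm.ofBasis, absK_one, absK_zero]
  have hs : ∀ v, M.norm.toFun v = max (absK (b.repr v 0) * M.norm.toFun (b 0))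
      (absK (b.repr v 1) * M.norm.toFun (b 1)) := fun v => by
    rw [h1, h1]; exact latticeFun_eq M.carrier b hb v
  refine (latticeFun_eq _ b' rfl v).trans ?_
  refine Eq.trans ?_ ((one_mul _).symm.trans (congrArg _ (pushFun_eq _ M.norm b b' hb' hs v).symm))
  simp [SplitNorm.ofBasis, h1]

end Push

end Tree

/-! ### The product of trees -/

section Product

variable {p : ℕ} [Fact p.Prime] {F k : Type*} [Field F] [Field k]
  [Algebra (ZMod p) F] [Algebra (ZMod p) k]

/-- The component of the induced map from the tree at `i - 1` to the tree at `i`. -/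
def phiBar (A : GL (Fin 2) (F ⊗[ZMod p] k)⸨X⸩) (i : k →ₐ[ZMod p] F) : Tree F → Tree F :=
  treeMap p (comp A i)

/-- The map induced by `Φ_A` on the product of the trees over all embeddings `i`. -/
def phiBarA (A : GL (Fin 2) (F ⊗[ZMod p] k)⸨X⸩) (P : (k →ₐ[ZMod p] F) → Tree F) :
    (k →ₐ[ZMod p] F) → Tree F :=
  fun i => phiBar A i (P (pred i))

end Product

end Kisin

end

/-! Composing the maps `PhiComp` once around the cycle of embeddings gives a semilinear map `Ψ` of a
plane over `F((u))`, relative to `σ : u ↦ u ^ q` with `q = p ^ n`. A line stable under `Ψ` would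
spread to a stable family of lines, so simplicity forbids it (`IsSimplePhi.not_stable_lines`).

Write `Ψ²e = a Ψe + b e`. The line of `Ψe + x e` is stable as soon as `x (σ x + a) = b`. Successive
approximation solves this equation when `|b| ^ q < |a| ^ (q + 1)`, and also when the inequality is
reversed (weakly) and `q + 1` divides `ord b`. In the only remaining case a second functional
equation yields a vector `e` with `Ψ²e = l e` and `q + 1 ∤ ord l` (`exists_swapped_lines`). Thus `Ψ`
swaps two lines, and their images under the partial composites are a pair of lines in every factor,
permuted by `Φ_A`.

The fixed point is a norm split by these lines. In the first factor the logarithms of its values on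
`e` and `Ψe` differ by `t = ord l / (q + 1)`, and in the `j`-th by `t p ^ j`. These numbers are not
integers, since `q + 1` is prime to `p`; hence no `P_i` is a vertex. Uniqueness holds because the
tree maps multiply distances by at least `p`.

As `P_i` is interior to an edge, every lattice lies strictly on one of its two sides, that is, leans
towards one of the two lines. If the side of `M_i` were always the image of the side of `M_{i-1}`,
the chosen lines would form a stable family. So at some `i` the two lattices lie on opposite sides
of `P_i`, which is then on the geodesic between them (`Tree.mem_geodesic_of_leans`). -/

namespace Kisin

/-! ### The absolute value of `F((u))` and its contraction principle. -/

section AbsoluteValue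

variable {F : Type*} [Field F]

/-- The absolute value of `F((u))` as a multiplicative map. -/
noncomputable def absHom (F : Type*) [Field F] : F⸨X⸩ →*₀ ℝ where
  toFun := absK
  map_zero' := absK_zero
  map_one' := absK_one
  map_mul' := absK_mul

theorem absK_div (x y : F⸨X⸩) : absK (x / y) = absK x / absK y := map_div₀ (absHom F) x y

theorem absK_pos {x : F⸨X⸩} (hx : x ≠ 0) : 0 < absK x :=
  lt_of_le_of_ne (absK_nonneg x) fun h => hx (absK_eq_zero.1 h.symm)

theorem absK_neg (x : F⸨X⸩) : absK (-x) = absK x := by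
  by_cases hx : x = 0
  · simp [hx]
  rw [absK_of_ne hx, absK_of_ne (neg_ne_zero.2 hx), HahnSeries.order_neg]

theorem absK_sub (x y : F⸨X⸩) : absK (x - y) ≤ max (absK x) (absK y) := by
  rw [sub_eq_add_neg, ← absK_neg y]; exact absK_add _ _

theorem absK_sub_comm (x y : F⸨X⸩) : absK (x - y) = absK (y - x) := by
  rw [← absK_neg, neg_sub]

theorem absK_add_eq_right {x y : F⸨X⸩} (h : absK x < absK y) : absK (x + y) = absK y := by
  refine le_antisymm ((absK_add x y).trans (max_le h.le le_rfl)) ?_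
  have := absK_sub (x + y) x
  rw [add_sub_cancel_left] at this
  rcases le_max_iff.1 this with h' | h'
  · exact h'
  · exact absurd h (not_lt.2 h')

/-- The valuation is discrete, so any strict inequality `|x| < 1` supplies the contraction constant
`e⁻¹` of `exists_fixedPoint`. -/
theorem absK_le_exp_neg_one {x : F⸨X⸩} (hx : absK x < 1) : absK x ≤ Real.exp (-1) := by
  by_cases h0 : x = 0
  · rw [h0, absK_zero]; positivity
  rw [absK_of_ne h0] at hx ⊢
  rw [Real.exp_lt_one_iff, neg_lt_zero] at hx
  have h1 : (0 : ℤ) < x.order := by exact_mod_cast hx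
  have h2 : (1 : ℝ) ≤ x.order := by exact_mod_cast h1
  gcongr

theorem absK_le_exp_iff {x : F⸨X⸩} {k : ℤ} :
    absK x ≤ Real.exp (-(k : ℝ)) ↔ ∀ m < k, x.coeff m = 0 := by
  by_cases h0 : x = 0
  · simp only [h0, absK_zero, HahnSeries.coeff_zero, implies_true, iff_true]; positivity
  rw [absK_of_ne h0, Real.exp_le_exp, neg_le_neg_iff, Int.cast_le]
  constructor
  · exact fun h m hm => HahnSeries.coeff_eq_zero_of_lt_order (hm.trans_le h)
  · intro h
    by_contra hc
    exact h0 (HahnSeries.coeff_order_eq_zero.1 (h _ (not_le.1 hc)))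

theorem absK_le_one_iff {x : F⸨X⸩} : absK x ≤ 1 ↔ ∀ m < (0 : ℤ), x.coeff m = 0 := by
  rw [← absK_le_exp_iff]; simp

theorem absK_C {a : F} (ha : a ≠ 0) : absK (HahnSeries.C a : F⸨X⸩) = 1 := by
  rw [absK_of_ne (HahnSeries.C_ne_zero ha), HahnSeries.order_C]; simp

theorem absK_C_le (a : F) : absK (HahnSeries.C a : F⸨X⸩) ≤ 1 := by
  by_cases ha : a = 0
  · simp [ha, absK_zero]
  · exact (absK_C ha).le

theorem absK_single (m : ℤ) : absK (HahnSeries.single m 1 : F⸨X⸩) = Real.exp (-(m : ℝ)) := by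
  have h : (HahnSeries.single m 1 : F⸨X⸩) ≠ 0 := HahnSeries.single_ne_zero one_ne_zero
  rw [absK_of_ne h, HahnSeries.order_single one_ne_zero]

theorem absK_sub_C_coeff {x : F⸨X⸩} (hx : absK x ≤ 1) :
    absK (x - HahnSeries.C (x.coeff 0)) ≤ Real.exp (-1) := by
  have : absK (x - HahnSeries.C (x.coeff 0)) ≤ Real.exp (-((1 : ℤ) : ℝ)) := by
    refine absK_le_exp_iff.2 fun m hm => ?_
    rw [HahnSeries.coeff_sub]
    rcases (Int.lt_add_one_iff.1 (show m < 0 + 1 by simpa using hm)).lt_or_eq with h | rfl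
    · rw [absK_le_one_iff.1 hx m h, HahnSeries.C_apply, HahnSeries.coeff_single_of_ne h.ne,
        sub_zero]
    · simp
  simpa using this

/-- The Banach fixed point theorem on the unit ball of `F((u))`. -/
theorem exists_fixedPoint (T : F⸨X⸩ → F⸨X⸩) (hT : ∀ x, absK x ≤ 1 → absK (T x) ≤ 1)
    (hc : ∀ x y, absK x ≤ 1 → absK y ≤ 1 → absK (T x - T y) ≤ Real.exp (-1) * absK (x - y)) :
    ∃ z, absK z ≤ 1 ∧ T z = z := by
  have hz0 : absK (0 : F⸨X⸩) ≤ 1 := by rw [absK_zero]; exact zero_le_one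
  have hit : ∀ m, absK (T^[m] 0) ≤ 1 := by
    intro m
    induction m with
    | zero => exact hz0
    | succ m ih => rw [Function.iterate_succ_apply']; exact hT _ ih
  have hstep : ∀ m j, absK (T^[m + j] 0 - T^[m] 0) ≤ Real.exp (-(m : ℝ)) := by
    intro m j
    induction m with
    | zero =>
      refine (absK_sub _ _).trans ?_
      simpa only [Nat.cast_zero, neg_zero, Real.exp_zero, max_le_iff] using ⟨hit (0 + j), hit 0⟩
    | succ m ih =>
      rw [Nat.succ_add, Function.iterate_succ_apply', Function.iterate_succ_apply']
      refine (hc _ _ (hit _) (hit _)).trans ?_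
      refine (mul_le_mul_of_nonneg_left ih (Real.exp_pos _).le).trans ?_
      rw [← Real.exp_add]; push_cast; rw [neg_add, add_comm]
  -- By `hstep`, the coefficient of `u ^ j` no longer changes from the iterate `j + 1` on, so the
  -- limit can be written down coefficientwise.
  obtain ⟨z, hz⟩ : ∃ z : F⸨X⸩, ∀ j : ℤ, z.coeff j = if j < 0 then 0
      else (T^[j.toNat + 1] 0).coeff j := by
    refine ⟨((PowerSeries.mk fun k => (T^[k + 1] 0).coeff (k : ℤ) : F⟦X⟧) : F⸨X⸩), fun j => ?_⟩
    rw [PowerSeries.coeff_coe]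
    split_ifs with h
    · rfl
    · rw [PowerSeries.coeff_mk, Int.natAbs_of_nonneg (not_lt.1 h), ← Int.toNat_of_nonneg (not_lt.1 h)]
      rw [Int.natAbs_natCast, Int.toNat_natCast]
  have happ : ∀ m : ℕ, absK (z - T^[m] 0) ≤ Real.exp (-(m : ℝ)) := by
    intro m
    have : absK (z - T^[m] 0) ≤ Real.exp (-((m : ℤ) : ℝ)) := by
      refine absK_le_exp_iff.2 fun j hj => ?_
      rw [HahnSeries.coeff_sub, hz]
      split_ifs with h
      · rw [absK_le_one_iff.1 (hit m) j h, sub_zero]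
      · obtain ⟨i, rfl⟩ := Int.eq_ofNat_of_zero_le (not_lt.1 h)
        obtain ⟨d, rfl⟩ : ∃ d, m = i + 1 + d := ⟨m - (i + 1), by omega⟩
        have h1 : absK (T^[i + 1 + d] 0 - T^[i + 1] 0) ≤ Real.exp (-(((i + 1 : ℕ) : ℤ) : ℝ)) := by
          exact_mod_cast hstep (i + 1) d
        have h2 := absK_le_exp_iff.1 h1 i (by push_cast; omega)
        rw [HahnSeries.coeff_sub] at h2
        rw [Int.toNat_natCast, ← neg_sub, h2, neg_zero]
    exact_mod_cast this
  have hz1 : absK z ≤ 1 := by simpa using happ 0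
  refine ⟨z, hz1, ?_⟩
  have hall : ∀ m : ℕ, absK (T z - z) ≤ Real.exp (-(m : ℝ)) := by
    intro m
    have h1 : absK (T z - T^[m + 1] 0) ≤ Real.exp (-(m : ℝ)) := by
      rw [Function.iterate_succ_apply']
      refine (hc _ _ hz1 (hit m)).trans ?_
      refine (mul_le_of_le_one_left (absK_nonneg _) ?_).trans (happ m)
      simp
    have h2 : absK (z - T^[m + 1] 0) ≤ Real.exp (-(m : ℝ)) := by
      refine (happ (m + 1)).trans ?_
      gcongr; simp
    have h3 := absK_sub (T z - T^[m + 1] 0) (z - T^[m + 1] 0)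
    rw [sub_sub_sub_cancel_right] at h3
    exact h3.trans (max_le h1 h2)
  by_contra hne
  have h0 : T z - z ≠ 0 := sub_ne_zero.2 hne
  have := absK_pos h0
  rw [absK_of_ne h0] at hall
  obtain ⟨m, hm⟩ := exists_nat_gt ((T z - z).order : ℝ)
  have := hall m
  rw [Real.exp_le_exp] at this
  linarith

end AbsoluteValue

/-! ### Solving the equations for stable and for swapped lines. -/

section FunctionalEquations

variable {F : Type*} [Field F] {σ : F⸨X⸩ →+* F⸨X⸩} {q : ℕ}

theorem absK_map_sub_le (hq : q ≠ 0) (hσ : ∀ x, absK (σ x) = absK x ^ q) {x y : F⸨X⸩}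
    (hx : absK x ≤ 1) (hy : absK y ≤ 1) : absK (σ x - σ y) ≤ absK (x - y) := by
  rw [← map_sub, hσ]
  exact pow_le_of_le_one (absK_nonneg _) ((absK_sub x y).trans (max_le hx hy)) hq

theorem absK_mul_sub_mul_le {x y x' y' : F⸨X⸩} {r : ℝ} (hx : absK x ≤ 1) (hy' : absK y' ≤ 1)
    (h : absK (x - x') ≤ r) (h' : absK (y - y') ≤ r) : absK (x * y - x' * y') ≤ r := by
  have e : x * y - x' * y' = x * (y - y') + (x - x') * y' := by ring
  rw [e]
  refine (absK_add _ _).trans (max_le ?_ ?_)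
  · rw [absK_mul]; exact (mul_le_of_le_one_left (absK_nonneg _) hx).trans h'
  · rw [absK_mul]; exact (mul_le_of_le_one_right (absK_nonneg _) hy').trans h

/-- The term `a x` dominates, so `x` is close to `b / a`. With `x = (b / a) y` the equation becomes
`y = 1 - g y σ(y)`, where `|g| = |b| ^ q / |a| ^ (q + 1) < 1`, and the right side is a contraction.
-/
theorem exists_mul_map_add_eq_of_lt (hq : q ≠ 0) (hσ : ∀ x, absK (σ x) = absK x ^ q)
    {a b : F⸨X⸩} (h : absK b ^ q < absK a ^ (q + 1)) : ∃ x, x * (σ x + a) = b := by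
  have ha : a ≠ 0 := by
    rintro rfl
    rw [absK_zero, zero_pow q.succ_ne_zero] at h
    exact absurd h (not_lt.2 (pow_nonneg (absK_nonneg _) _))
  have ha' := absK_pos ha
  obtain ⟨g, hg⟩ : ∃ g, g = σ (b / a) / a := ⟨_, rfl⟩
  have hg1 : absK g ≤ Real.exp (-1) := by
    refine absK_le_exp_neg_one ?_
    rw [hg, absK_div, hσ, absK_div, div_pow, div_div, div_lt_one (by positivity), ← pow_succ]
    exact h
  have hg2 : absK g ≤ 1 := hg1.trans (by simp)
  have hσ1 : ∀ x, absK x ≤ 1 → absK (σ x) ≤ 1 := fun x hx => by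
    rw [hσ]; exact pow_le_one₀ (absK_nonneg _) hx
  obtain ⟨y, -, hy⟩ := exists_fixedPoint (fun y => 1 - g * (y * σ y)) (fun x hx => by
      refine (absK_sub _ _).trans (max_le absK_one.le ?_)
      rw [absK_mul, absK_mul]
      exact mul_le_one₀ hg2 (mul_nonneg (absK_nonneg _) (absK_nonneg _))
        (mul_le_one₀ hx (absK_nonneg _) (hσ1 x hx))) (fun x y hx hy => by
      have e : 1 - g * (x * σ x) - (1 - g * (y * σ y)) = g * (y * σ y - x * σ x) := by ring
      rw [e, absK_mul, absK_sub_comm x y]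
      exact mul_le_mul hg1 (absK_mul_sub_mul_le hy (hσ1 x hx) le_rfl
        (absK_map_sub_le hq hσ hy hx)) (absK_nonneg _) (Real.exp_pos _).le)
  refine ⟨b / a * y, ?_⟩
  have hy' : y + g * (y * σ y) = 1 := by linear_combination hy.symm
  have e : b / a * y * (σ (b / a * y) + a) = b * (y + g * (y * σ y)) := by
    rw [hg, map_mul]; field_simp; ring
  rw [e, hy', mul_one]

/-- If `Ψ²e = a Ψe + b e`, this is the condition that `Ψ²` preserve the line of `Ψe + x e`. To first
order `x` is `b σ(a) / σ(b)`; dividing by this value leaves a fixed point equation for `y` whose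
coefficients `d`, `g` and `d g` all have absolute value less than 1. -/
theorem exists_mul_eq_of_lt (hq : 2 ≤ q) (hσ : ∀ x, absK (σ x) = absK x ^ q)
    {a b : F⸨X⸩} (h : absK a ^ (q + 1) < absK b ^ q) :
    ∃ x, x * (σ b + a * σ a + a * σ (σ x)) = b * (σ a + σ (σ x)) := by
  have hq0 : q ≠ 0 := by omega
  have hb : b ≠ 0 := by
    rintro rfl
    rw [absK_zero, zero_pow hq0] at h
    exact absurd h (not_lt.2 (pow_nonneg (absK_nonneg _) _))
  by_cases ha : a = 0
  · exact ⟨0, by simp [ha]⟩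
  have hσ0 : ∀ {x}, x ≠ 0 → σ x ≠ 0 := fun hx => (map_ne_zero σ).2 hx
  have ha' := absK_pos ha
  have hb' := absK_pos hb
  obtain ⟨c, hc⟩ : ∃ c, c = σ (σ (b * σ a / σ b)) := ⟨_, rfl⟩
  obtain ⟨d, hd⟩ : ∃ d, d = c / σ a := ⟨_, rfl⟩
  obtain ⟨g, hg⟩ : ∃ g, g = a * σ a / σ b := ⟨_, rfl⟩
  have hd1 : absK d ≤ Real.exp (-1) := by
    refine absK_le_exp_neg_one ?_
    obtain ⟨r, rfl⟩ : ∃ r, q = r + 2 := ⟨q - 2, by omega⟩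
    rw [hd, hc, absK_div, hσ, hσ, absK_div, absK_mul, hσ, hσ, div_pow, div_pow, div_div,
      div_lt_one (by positivity)]
    -- After cancellation `|d| < 1` reads `|a| ^ (q ^ 3 - q) < |b| ^ (q ^ 3 - q ^ 2)`, which is the
    -- hypothesis raised to the power `q (q - 1)`.
    have h1 := pow_lt_pow_left₀ h (by positivity) (n := (r + 2) * (r + 1)) (by positivity)
    have e1 : ((absK b * absK a ^ (r + 2)) ^ (r + 2)) ^ (r + 2) =
        absK b ^ ((r + 2) * (r + 2)) * absK a ^ (r + 2) *
          (absK a ^ (r + 2 + 1)) ^ ((r + 2) * (r + 1)) := by ring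
    have e2 : ((absK b ^ (r + 2)) ^ (r + 2)) ^ (r + 2) * absK a ^ (r + 2) =
        absK b ^ ((r + 2) * (r + 2)) * absK a ^ (r + 2) *
          (absK b ^ (r + 2)) ^ ((r + 2) * (r + 1)) := by ring
    rw [e1, e2]
    exact mul_lt_mul_of_pos_left h1 (by positivity)
  have hg1 : absK g ≤ Real.exp (-1) := by
    refine absK_le_exp_neg_one ?_
    rw [hg, absK_div, absK_mul, hσ, hσ, div_lt_one (by positivity), ← pow_succ']
    exact h
  have he1 : Real.exp (-1) ≤ 1 := by simp
  have hσ1 : ∀ x, absK x ≤ 1 → absK (σ x) ≤ 1 := fun x hx => by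
    rw [hσ]; exact pow_le_one₀ (absK_nonneg _) hx
  have hσ2 : ∀ x, absK x ≤ 1 → absK (σ (σ x)) ≤ 1 := fun x hx => hσ1 _ (hσ1 _ hx)
  have hdg : absK (d * g) ≤ Real.exp (-1) := by
    rw [absK_mul]
    exact (mul_le_of_le_one_right (absK_nonneg _) (hg1.trans he1)).trans hd1
  obtain ⟨y, -, hy⟩ := exists_fixedPoint
    (fun y => 1 + (d * σ (σ y) - g * y - d * g * (y * σ (σ y))))
    (fun x hx => by
      have aux : ∀ s t : F⸨X⸩, absK s ≤ Real.exp (-1) → absK t ≤ 1 → absK (s * t) ≤ 1 :=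
        fun s t hs ht => by
          rw [absK_mul]; exact mul_le_one₀ (hs.trans he1) (absK_nonneg _) ht
      refine (absK_add _ _).trans (max_le absK_one.le ?_)
      refine (absK_sub _ _).trans (max_le ((absK_sub _ _).trans (max_le ?_ ?_)) ?_)
      · exact aux _ _ hd1 (hσ2 x hx)
      · exact aux _ _ hg1 hx
      · refine aux _ _ hdg ?_
        rw [absK_mul]; exact mul_le_one₀ hx (absK_nonneg _) (hσ2 x hx))
    (fun x y hx hy => by
      have h2 : absK (σ (σ x) - σ (σ y)) ≤ absK (x - y) :=
        (absK_map_sub_le hq0 hσ (hσ1 x hx) (hσ1 y hy)).trans (absK_map_sub_le hq0 hσ hx hy)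
      have aux : ∀ s t : F⸨X⸩, absK s ≤ Real.exp (-1) → absK t ≤ absK (x - y) →
          absK (s * t) ≤ Real.exp (-1) * absK (x - y) := fun s t hs ht => by
        rw [absK_mul]; exact mul_le_mul hs ht (absK_nonneg _) (Real.exp_pos _).le
      have e : 1 + (d * σ (σ x) - g * x - d * g * (x * σ (σ x))) -
          (1 + (d * σ (σ y) - g * y - d * g * (y * σ (σ y)))) =
          d * (σ (σ x) - σ (σ y)) - g * (x - y) - d * g * (x * σ (σ x) - y * σ (σ y)) := by ring
      rw [e]
      refine (absK_sub _ _).trans (max_le ((absK_sub _ _).trans (max_le ?_ ?_)) ?_)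
      · exact aux _ _ hd1 h2
      · exact aux _ _ hg1 le_rfl
      · exact aux _ _ hdg (absK_mul_sub_mul_le hx (hσ2 y hy) le_rfl h2))
  refine ⟨b * σ a / σ b * y, ?_⟩
  have hy' : y - (1 + (d * σ (σ y) - g * y - d * g * (y * σ (σ y)))) = 0 := by
    linear_combination hy.symm
  have hsb := hσ0 hb
  have hsa := hσ0 ha
  rw [map_mul, map_mul, ← hc, ← sub_eq_zero]
  have e : b * σ a / σ b * y * (σ b + a * σ a + a * (c * σ (σ y))) - b * (σ a + c * σ (σ y)) =
      b * σ a * (y - (1 + (d * σ (σ y) - g * y - d * g * (y * σ (σ y))))) := by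
    rw [hd, hg]; field_simp; ring
  rw [e, hy', mul_zero]

/-- Divisibility allows rescaling `x` by `w = u ^ m` to make the constant term a unit and the linear
coefficient integral. Modulo `u` the equation is then a quadratic over `F`, because `σ` fixes
constants; a root is lifted as in Hensel's lemma. -/
theorem exists_mul_map_add_eq_of_dvd [IsAlgClosed F] (hq : 2 ≤ q)
    (hσ : ∀ x, absK (σ x) = absK x ^ q) {a b : F⸨X⸩} (hb : b ≠ 0)
    (h : absK a ^ (q + 1) ≤ absK b ^ q) (hdvd : ((q : ℤ) + 1) ∣ b.order)
    (hσC : ∀ c : F, σ (HahnSeries.C c) = HahnSeries.C c) : ∃ x, x * (σ x + a) = b := by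
  obtain ⟨m, hm⟩ := hdvd
  obtain ⟨w, hw⟩ : ∃ w : F⸨X⸩, w = HahnSeries.single m 1 := ⟨_, rfl⟩
  obtain ⟨u, hu⟩ : ∃ u : F⸨X⸩, u = HahnSeries.single 1 1 := ⟨_, rfl⟩
  have hw0 : w ≠ 0 := hw ▸ HahnSeries.single_ne_zero one_ne_zero
  have hu0 : u ≠ 0 := hu ▸ HahnSeries.single_ne_zero one_ne_zero
  have hwa : absK w = Real.exp (-(m : ℝ)) := by rw [hw, absK_single]
  have hua : absK u = Real.exp (-1) := by rw [hu, absK_single]; simp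
  have hσw : σ w ≠ 0 := (map_ne_zero σ).2 hw0
  have hwp := absK_pos hw0
  have hbw : absK b = absK w ^ (q + 1) := by
    rw [absK_of_ne hb, hm, hwa, ← Real.exp_nat_mul]; push_cast; ring_nf
  obtain ⟨a', ha'⟩ : ∃ a', a' = a / σ w := ⟨_, rfl⟩
  obtain ⟨c, hc⟩ : ∃ c, c = b / (w * σ w) := ⟨_, rfl⟩
  have hca : absK c = 1 := by
    rw [hc, absK_div, absK_mul, hσ, hbw, ← pow_succ', div_self (by positivity)]
  have haa : absK a' ≤ 1 := by
    rw [ha', absK_div, hσ, div_le_one (by positivity)]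
    rw [hbw, ← pow_mul, mul_comm, pow_mul] at h
    exact (pow_le_pow_iff_left₀ (absK_nonneg _) (by positivity) q.succ_ne_zero).1 h
  have ha0 := absK_sub_C_coeff haa
  have hc0 := absK_sub_C_coeff hca.le
  have he1 : Real.exp (-1) < 1 := by simp
  have hcne : c.coeff 0 ≠ 0 := fun hz => by
    rw [hz, map_zero, sub_zero, hca] at hc0
    exact absurd hc0 (not_le.2 he1)
  obtain ⟨y₀, hy₀⟩ : ∃ y₀ : F, y₀ * (y₀ + a'.coeff 0) = c.coeff 0 := by
    have hdeg : (Polynomial.X ^ 2 + Polynomial.C (a'.coeff 0) * Polynomial.X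
        - Polynomial.C (c.coeff 0) : Polynomial F).degree = 2 := by compute_degree!
    obtain ⟨y, hy⟩ := IsAlgClosed.exists_root _ (by rw [hdeg]; norm_num)
    refine ⟨y, ?_⟩
    simp only [Polynomial.IsRoot.def, Polynomial.eval_sub, Polynomial.eval_add,
      Polynomial.eval_pow, Polynomial.eval_X, Polynomial.eval_mul, Polynomial.eval_C] at hy
    linear_combination hy
  -- This is the simple-root condition: `σ (u z)` is divisible by `u ^ q` with `q ≥ 2`, so the
  -- linearized equation for the correction `u z` has leading coefficient `Y + a'`.
  have hy1 : y₀ + a'.coeff 0 ≠ 0 := fun hz => hcne (by rw [← hy₀, hz, mul_zero])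
  obtain ⟨Y, hY⟩ : ∃ Y : F⸨X⸩, Y = HahnSeries.C y₀ := ⟨_, rfl⟩
  have hYa : absK Y ≤ 1 := hY ▸ absK_C_le _
  obtain ⟨d, hd⟩ : ∃ d, d = (c - Y * Y - a' * Y) / u := ⟨_, rfl⟩
  have hda : absK d ≤ 1 := by
    have e : c - Y * Y - a' * Y = (c - HahnSeries.C (c.coeff 0)) -
        (a' - HahnSeries.C (a'.coeff 0)) * Y := by
      rw [← hy₀, hY, map_mul, map_add]; ring
    rw [hd, absK_div, hua, div_le_one (Real.exp_pos _), e]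
    refine (absK_sub _ _).trans (max_le hc0 ?_)
    rw [absK_mul]
    exact (mul_le_of_le_one_right (absK_nonneg _) hYa).trans ha0
  have hv : absK (Y + a') = 1 := by
    have e : Y + a' = (a' - HahnSeries.C (a'.coeff 0)) + HahnSeries.C (y₀ + a'.coeff 0) := by
      rw [hY, map_add]; ring
    rw [e, absK_add_eq_right, absK_C hy1]
    rw [absK_C hy1]; exact ha0.trans_lt he1
  have hv0 : Y + a' ≠ 0 := fun hz => by rw [hz, absK_zero] at hv; exact zero_ne_one hv
  obtain ⟨g, hg⟩ : ∃ g, g = σ u / u := ⟨_, rfl⟩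
  have hg1 : absK g ≤ Real.exp (-1) := by
    rw [hg, absK_div, hσ, hua, div_le_iff₀ (Real.exp_pos _), ← pow_two]
    exact pow_le_pow_of_le_one (Real.exp_pos _).le he1.le hq
  have hσ1 : ∀ x, absK x ≤ 1 → absK (σ x) ≤ 1 := fun x hx => by
    rw [hσ]; exact pow_le_one₀ (absK_nonneg _) hx
  have hY1 : ∀ x, absK x ≤ 1 → absK (Y + u * x) ≤ 1 := fun x hx => by
    refine (absK_add _ _).trans (max_le hYa ?_)
    rw [absK_mul, hua]; exact mul_le_one₀ he1.le (absK_nonneg _) hx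
  obtain ⟨z, -, hz⟩ := exists_fixedPoint
    (fun z => (d - g * (σ z * (Y + u * z))) / (Y + a'))
    (fun x hx => by
      rw [absK_div, hv, div_one]
      refine (absK_sub _ _).trans (max_le hda ?_)
      rw [absK_mul, absK_mul]
      exact mul_le_one₀ (hg1.trans he1.le) (mul_nonneg (absK_nonneg _) (absK_nonneg _))
        (mul_le_one₀ (hσ1 x hx) (absK_nonneg _) (hY1 x hx)))
    (fun x y hx hy => by
      have e : (d - g * (σ x * (Y + u * x))) / (Y + a') - (d - g * (σ y * (Y + u * y))) / (Y + a')
          = g * (σ y * (Y + u * y) - σ x * (Y + u * x)) / (Y + a') := by ring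
      rw [e, absK_div, hv, div_one, absK_mul, absK_sub_comm x y]
      refine mul_le_mul hg1 (absK_mul_sub_mul_le (hσ1 y hy) (hY1 x hx)
        (absK_map_sub_le (by omega) hσ hy hx) ?_) (absK_nonneg _) (Real.exp_pos _).le
      rw [add_sub_add_left_eq_sub, ← mul_sub, absK_mul, hua]
      exact mul_le_of_le_one_left (absK_nonneg _) he1.le)
  refine ⟨w * (Y + u * z), ?_⟩
  have hz' : z * (Y + a') * u = c - Y * Y - a' * Y - σ u * (σ z * (Y + u * z)) := by
    have h1 : z * (Y + a') = d - g * (σ z * (Y + u * z)) := by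
      exact ((div_eq_iff hv0).1 hz).symm
    rw [h1, hd, hg]; field_simp
  have e : w * (Y + u * z) * (σ (w * (Y + u * z)) + a) =
      w * σ w * ((Y + u * z) * (Y + σ u * σ z + a')) := by
    rw [ha', map_mul, map_add, map_mul, hY, hσC]; field_simp
  rw [e, show (Y + u * z) * (Y + σ u * σ z + a') = c by linear_combination hz', hc]
  field_simp

end FunctionalEquations

/-! ### Normal form of a semilinear map without stable lines. -/

section NormalForm

theorem smul_add_smul_eq {R M : Type*} [CommRing R] [AddCommGroup M] [Module R M] (a s x : R)
    (v w : M) : a • w + (x * (s + a)) • v + s • w = (s + a) • (w + x • v) := by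
  module

theorem smul_add_smul_eq_smul {R M : Type*} [CommRing R] [AddCommGroup M] [Module R M]
    {a b c s t l x : R} (v w : M) (hl : l = a * (t + s) + c) (h : l * x = b * (s + t)) :
    s • (a • w + b • v) + c • w + t • (a • w + b • v) = l • (w + x • v) := by
  rw [smul_add l, smul_smul l, h, hl]
  module

variable {F : Type*} [Field F] [IsAlgClosed F] {σ : F⸨X⸩ →+* F⸨X⸩} {q : ℕ}

/-- A semilinear map in dimension two without stable line swaps two lines. -/
theorem exists_swapped_lines (hq : 2 ≤ q) (hσ : ∀ x, absK (σ x) = absK x ^ q)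
    (hσC : ∀ c : F, σ (HahnSeries.C c) = HahnSeries.C c)
    (Ψ : (Fin 2 → F⸨X⸩) →ₛₗ[σ] (Fin 2 → F⸨X⸩)) (hline : ∀ v ≠ 0, ∀ μ : F⸨X⸩, Ψ v ≠ μ • v) :
    ∃ (e : Fin 2 → F⸨X⸩) (l : F⸨X⸩), LinearIndependent F⸨X⸩ ![e, Ψ e] ∧ Ψ (Ψ e) = l • e ∧ l ≠ 0 ∧
      ¬ ((q : ℤ) + 1) ∣ l.order := by
  have hli : ∀ e ≠ 0, LinearIndependent F⸨X⸩ ![e, Ψ e] := fun e he =>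
    (LinearIndependent.pair_iff' he).2 fun μ h => hline e he μ h.symm
  have hrel : ∀ e ≠ 0, ∃ a b : F⸨X⸩, Ψ (Ψ e) = a • Ψ e + b • e := by
    intro e he
    have hb := (basisOfLinearIndependentOfCardEqFinrank (hli e he) (by simp)).sum_repr (Ψ (Ψ e))
    rw [Fin.sum_univ_two] at hb
    simp only [coe_basisOfLinearIndependentOfCardEqFinrank, Matrix.cons_val_zero,
      Matrix.cons_val_one] at hb
    exact ⟨_, _, by rw [add_comm]; exact hb.symm⟩
  have hsum : ∀ e ≠ 0, ∀ x : F⸨X⸩, Ψ e + x • e ≠ 0 := fun e he x h =>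
    hline e he (-x) (by rw [neg_smul]; exact eq_neg_of_add_eq_zero_left h)
  have hno : ∀ e ≠ 0, ∀ a b : F⸨X⸩, Ψ (Ψ e) = a • Ψ e + b • e → ∀ x, x * (σ x + a) ≠ b := by
    intro e he a b h x hx
    refine hline _ (hsum e he x) (σ x + a) ?_
    rw [map_add, LinearMap.map_smulₛₗ, h, ← hx]
    exact smul_add_smul_eq _ _ _ _ _
  have hb0 : ∀ e ≠ 0, ∀ a b : F⸨X⸩, Ψ (Ψ e) = a • Ψ e + b • e → b ≠ 0 := by
    intro e he a b h hb
    exact hno e he a b h 0 (by rw [hb, zero_mul])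
  -- Both solvable cases would give a stable line; this holds for every nonzero vector, and is used
  -- again for the new one at the end.
  have h1 : ∀ e ≠ 0, ∀ a b : F⸨X⸩, Ψ (Ψ e) = a • Ψ e + b • e →
      absK a ^ (q + 1) ≤ absK b ^ q ∧ ¬ ((q : ℤ) + 1) ∣ b.order := by
    intro e he a b h
    have hle : absK a ^ (q + 1) ≤ absK b ^ q := by
      by_contra hc
      obtain ⟨x, hx⟩ := exists_mul_map_add_eq_of_lt (by omega) hσ (not_le.1 hc)
      exact hno e he a b h x hx
    refine ⟨hle, fun hd => ?_⟩
    obtain ⟨x, hx⟩ := exists_mul_map_add_eq_of_dvd hq hσ (hb0 e he a b h) hle hd hσC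
    exact hno e he a b h x hx
  obtain ⟨e, he⟩ := exists_ne (0 : Fin 2 → F⸨X⸩)
  obtain ⟨a, b, hab⟩ := hrel e he
  obtain ⟨hle, hnd⟩ := h1 e he a b hab
  have hb := hb0 e he a b hab
  -- Equality would mean `(q + 1) ord a = q ord b`, and since `q` is prime to `q + 1` this forces `q
  -- + 1 ∣ ord b`.
  have hlt : absK a ^ (q + 1) < absK b ^ q := by
    refine lt_of_le_of_ne hle fun heq => hnd ?_
    have ha : a ≠ 0 := by
      rintro rfl
      rw [absK_zero, zero_pow q.succ_ne_zero] at heq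
      exact (pow_pos (absK_pos hb) q).ne heq
    rw [absK_of_ne ha, absK_of_ne hb, ← Real.exp_nat_mul, ← Real.exp_nat_mul,
      Real.exp_eq_exp] at heq
    have h2 : ((q : ℤ) + 1) * a.order = q * b.order := by
      have : ((q : ℝ) + 1) * a.order = q * b.order := by push_cast at heq; linarith
      exact_mod_cast this
    exact (IsCoprime.dvd_of_dvd_mul_left (by exact ⟨1, -1, by ring⟩) ⟨_, h2.symm⟩)
  obtain ⟨x, hx⟩ := exists_mul_eq_of_lt hq hσ hlt
  obtain ⟨l, hl⟩ : ∃ l, l = a * (σ (σ x) + σ a) + σ b := ⟨_, rfl⟩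
  have hΨ : Ψ (Ψ (Ψ e + x • e)) = l • (Ψ e + x • e) := by
    have h2 : Ψ (Ψ (Ψ e + x • e)) =
        σ a • (a • Ψ e + b • e) + σ b • Ψ e + σ (σ x) • (a • Ψ e + b • e) := by
      rw [map_add, LinearMap.map_smulₛₗ, map_add, LinearMap.map_smulₛₗ, hab, map_add,
        LinearMap.map_smulₛₗ, LinearMap.map_smulₛₗ, hab]
    rw [h2]
    exact smul_add_smul_eq_smul _ _ hl (by rw [hl]; linear_combination hx)
  -- The relation of the new vector has `a = 0` and `b = l`, so `h1` and `hb0` apply to `l`.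
  have h3 : Ψ (Ψ (Ψ e + x • e)) = (0 : F⸨X⸩) • Ψ (Ψ e + x • e) + l • (Ψ e + x • e) := by
    rw [hΨ, zero_smul, zero_add]
  exact ⟨_, l, hli _ (hsum e he x), hΨ, hb0 _ (hsum e he x) _ _ h3, (h1 _ (hsum e he x) _ _ h3).2⟩

end NormalForm

end Kisin

namespace Kisin

/-! ### The factors of `F ⊗ k` and the consequence of simplicity. -/

section Embeddings

variable {p : ℕ} [Fact p.Prime] {F k : Type*} [Field F] [Field k]
  [Algebra (ZMod p) F] [Algebra (ZMod p) k] [Finite k]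

/-- The embeddings `k → F` form a single cycle under `pred`. -/
theorem exists_cycle [IsAlgClosed F] : ∃ (n : ℕ) (s : ℕ → (k →ₐ[ZMod p] F))
    (m : (k →ₐ[ZMod p] F) → ℕ), n ≠ 0 ∧ s n = s 0 ∧ (∀ j, pred (s (j + 1)) = s j) ∧
      (∀ i, m i < n ∧ s (m i) = i) ∧ ∀ j < n, m (s j) = j := by
  have : Algebra.IsAlgebraic (ZMod p) k := Algebra.IsAlgebraic.of_finite _ _
  obtain ⟨f, hf⟩ : ∃ f, f = FiniteField.frobeniusAlgEquivOfAlgebraic (ZMod p) k := ⟨_, rfl⟩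
  have hbij : Function.Bijective fun n : Fin (Module.finrank (ZMod p) k) ↦ f ^ n.1 :=
    hf ▸ FiniteField.bijective_frobeniusAlgEquivOfAlgebraic_pow (ZMod p) k
  have hord : f ^ Module.finrank (ZMod p) k = 1 := by
    rw [hf, ← FiniteField.orderOf_frobeniusAlgEquivOfAlgebraic]; exact pow_orderOf_eq_one _
  obtain ⟨i₀⟩ : Nonempty (k →ₐ[ZMod p] F) := ⟨IsAlgClosed.lift⟩
  -- Inverse powers of Frobenius are used because `pred` composes with Frobenius and must lower the
  -- index.
  obtain ⟨s, hs⟩ : ∃ s : ℕ → (k →ₐ[ZMod p] F), ∀ j,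
      s j = i₀.comp ((f⁻¹ ^ j : Gal(k/ZMod p)) : k →ₐ[ZMod p] k) :=
    ⟨_, fun _ => rfl⟩
  have hinj : Function.Injective fun n : Fin (Module.finrank (ZMod p) k) ↦ s n := by
    intro a b hab
    refine hbij.1 (inv_injective ?_)
    simp only [← inv_pow]
    ext x
    refine i₀.injective ?_
    have := DFunLike.congr_fun hab x
    simpa [hs] using this
  have hb : Function.Bijective fun n : Fin (Module.finrank (ZMod p) k) ↦ s n := by
    rw [Fintype.bijective_iff_injective_and_card]
    exact ⟨hinj, by rw [Fintype.card_fin, AlgHom.card]⟩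
  obtain ⟨m, hm⟩ : ∃ m : (k →ₐ[ZMod p] F) → Fin (Module.finrank (ZMod p) k), ∀ i, s (m i) = i :=
    ⟨_, fun i => (hb.2 i).choose_spec⟩
  refine ⟨Module.finrank (ZMod p) k, s, fun i => m i, Module.finrank_pos.ne', ?_, fun j => ?_,
    fun i => ⟨(m i).2, hm i⟩, fun j hj => ?_⟩
  · rw [hs, hs, inv_pow, hord, inv_one, pow_zero]
  · ext x
    have : f⁻¹ (x ^ p) = x := by
      have h1 : f x = x ^ p := by rw [hf]; simp
      rw [← h1]; exact f.symm_apply_apply x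
    simp [pred, hs, pow_succ, this]
  · have := hinj (a₁ := m (s j)) (a₂ := ⟨j, hj⟩) (hm (s j))
    simp [this]

/-- The idempotents of `F ⊗ k`. -/
theorem exists_lift_eq_ite [DecidableEq (k →ₐ[ZMod p] F)] (i : k →ₐ[ZMod p] F) :
    ∃ z : F ⊗[ZMod p] k, ∀ j : k →ₐ[ZMod p] F,
      Algebra.TensorProduct.lift (AlgHom.id (ZMod p) F) j (fun _ _ => Commute.all _ _) z =
        if j = i then 1 else 0 := by
  have : Fintype (k →ₐ[ZMod p] F) := Fintype.ofFinite _
  let S : Submodule F ((k →ₐ[ZMod p] F) → F) :=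
    { carrier := {f | ∃ z : F ⊗[ZMod p] k, ∀ j : k →ₐ[ZMod p] F,
        Algebra.TensorProduct.lift (AlgHom.id (ZMod p) F) j (fun _ _ => Commute.all _ _) z = f j}
      zero_mem' := ⟨0, fun j => map_zero _⟩
      add_mem' := by
        rintro f g ⟨y, hy⟩ ⟨z, hz⟩
        exact ⟨y + z, fun j => by rw [map_add, hy, hz]; rfl⟩
      smul_mem' := by
        rintro c f ⟨z, hz⟩
        refine ⟨c ⊗ₜ 1 * z, fun j => ?_⟩
        rw [map_mul, hz, Algebra.TensorProduct.lift_tmul]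
        simp }
  have hS : S = ⊤ := by
    by_contra hne
    obtain ⟨f, hf, hle⟩ := Submodule.exists_le_ker_of_lt_top S (lt_top_iff_ne_top.2 hne)
    -- A linear form vanishing on the image of `F ⊗ k` is a linear relation among the embeddings,
    -- which Dedekind's independence of characters rules out.
    have h0 : ∑ j : k →ₐ[ZMod p] F, f (Pi.single j 1) • j.toLinearMap = 0 := by
      ext y
      have hy : (fun j : k →ₐ[ZMod p] F => j y) ∈ S := ⟨1 ⊗ₜ y, fun j => by simp⟩
      have h1 : f (fun j : k →ₐ[ZMod p] F => j y) = 0 := hle hy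
      rw [LinearMap.pi_apply_eq_sum_univ] at h1
      simp only [LinearMap.sum_apply, LinearMap.smul_apply, AlgHom.toLinearMap_apply, smul_eq_mul,
        LinearMap.zero_apply]
      rw [← h1]
      refine Finset.sum_congr rfl fun j _ => ?_
      rw [smul_eq_mul, mul_comm]
      congr 2
      ext l
      simp [Pi.single_apply, eq_comm]
    have h2 := Fintype.linearIndependent_iff.1 (linearIndependent_toLinearMap (ZMod p) k F) _ h0
    refine hf (LinearMap.pi_ext' fun j => LinearMap.ext_ring ?_)
    simpa using h2 j
  obtain ⟨z, hz⟩ : (fun j => if j = i then (1 : F) else 0) ∈ S := hS ▸ Submodule.mem_top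
  exact ⟨z, hz⟩

/-- An element of `F((u))` lifts to an element of `(F ⊗ k)((u))` concentrated at `i`. -/
theorem exists_proj_eq_ite [DecidableEq (k →ₐ[ZMod p] F)] (i : k →ₐ[ZMod p] F) (x : F⸨X⸩) :
    ∃ y : (F ⊗[ZMod p] k)⸨X⸩, ∀ j : k →ₐ[ZMod p] F, proj j y = if j = i then x else 0 := by
  obtain ⟨z, hz⟩ := exists_lift_eq_ite i
  refine ⟨mapCoeff (Algebra.TensorProduct.includeLeftRingHom) x * HahnSeries.C z, fun j => ?_⟩
  have h1 : proj j (mapCoeff (Algebra.TensorProduct.includeLeftRingHom) x) = x := by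
    ext g
    change Algebra.TensorProduct.lift (AlgHom.id (ZMod p) F) j (fun _ _ => Commute.all _ _)
      (x.coeff g ⊗ₜ 1) = _
    rw [Algebra.TensorProduct.lift_tmul]; simp
  have h2 : proj j (HahnSeries.C z : (F ⊗[ZMod p] k)⸨X⸩) = HahnSeries.C (if j = i then 1 else 0) := by
    rw [← hz j]
    ext g
    change Algebra.TensorProduct.lift (AlgHom.id (ZMod p) F) j (fun _ _ => Commute.all _ _)
      ((HahnSeries.C z).coeff g) = _
    simp only [HahnSeries.C_apply]
    by_cases hg : g = 0
    · rw [hg, HahnSeries.coeff_single_same, HahnSeries.coeff_single_same]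
    · rw [HahnSeries.coeff_single_of_ne hg, HahnSeries.coeff_single_of_ne hg, map_zero]
  rw [map_mul, h1, h2]
  split_ifs <;> simp

/-- A simple `φ`-module has no stable family of lines. -/
theorem IsSimplePhi.not_stable_lines {A : GL (Fin 2) (F ⊗[ZMod p] k)⸨X⸩} (hA : IsSimplePhi A)
    (w : (k →ₐ[ZMod p] F) → Fin 2 → F⸨X⸩) {i₀ : k →ₐ[ZMod p] F} (hw : w i₀ ≠ 0)
    (hs : ∀ i, ∃ μ : F⸨X⸩, PhiComp A i (w (pred i)) = μ • w i) : False := by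
  classical
  -- The vectors whose components all lie on the given lines. `W` is not `⊥` because `w i₀ ≠ 0`
  -- lifts to a vector concentrated at `i₀`, and not `⊤` because a line in the factor `i₀` does not
  -- contain both standard basis vectors.
  let W : Submodule (F ⊗[ZMod p] k)⸨X⸩ (Fin 2 → (F ⊗[ZMod p] k)⸨X⸩) :=
    { carrier := {v | ∀ i : k →ₐ[ZMod p] F, ∃ c : F⸨X⸩, (fun j => proj i (v j)) = c • w i}
      zero_mem' := fun i => ⟨0, by ext1 j; simp⟩
      add_mem' := by
        intro v v' hv hv' i
        obtain ⟨c, hc⟩ := hv i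
        obtain ⟨d, hd⟩ := hv' i
        refine ⟨c + d, ?_⟩
        rw [add_smul, ← hc, ← hd]
        ext1 j
        simp
      smul_mem' := by
        intro a v hv i
        obtain ⟨c, hc⟩ := hv i
        refine ⟨proj i a * c, ?_⟩
        rw [mul_smul, ← hc]
        ext1 j
        simp }
  have hW : ∀ v ∈ W, PhiA A v ∈ W := by
    intro v hv i
    obtain ⟨c, hc⟩ := hv (pred i)
    obtain ⟨μ, hμ⟩ := hs i
    refine ⟨expand F p c * μ, ?_⟩
    rw [proj_PhiA, hc, LinearMap.map_smulₛₗ, hμ, smul_smul]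
  rcases hA W hW with h | h
  · choose y hy using fun j => exists_proj_eq_ite i₀ (w i₀ j)
    have hyW : y ∈ W := by
      intro i
      by_cases hi : i = i₀
      · exact ⟨1, by ext1 j; simp [hy, hi]⟩
      · exact ⟨0, by ext1 j; simp [hy, hi]⟩
    rw [h, Submodule.mem_bot] at hyW
    refine hw (funext fun j => ?_)
    have := hy j i₀
    rw [if_pos rfl, hyW] at this
    simpa using this.symm
  · have h1 : ∀ l : Fin 2, Pi.single l 1 ∈ W := fun l => h ▸ Submodule.mem_top
    obtain ⟨c, hc⟩ := h1 0 i₀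
    obtain ⟨d, hd⟩ := h1 1 i₀
    have c0 := congrFun hc 0
    have c1 := congrFun hc 1
    have d1 := congrFun hd 1
    simp only [Pi.single_apply, Pi.smul_apply, smul_eq_mul] at c0 c1 d1
    simp only [if_true, map_one, one_ne_zero, if_false, map_zero] at c0 c1 d1
    rcases mul_eq_zero.1 c1.symm with h' | h'
    · rw [h', zero_mul] at c0; exact one_ne_zero c0
    · rw [h', mul_zero] at d1; exact one_ne_zero d1

end Embeddings

end Kisin

namespace Kisin

/-! ### Splittable norms, distances, and the two sides of a point inside an edge. -/

section Norms

variable {F : Type*} [Field F]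

namespace SplitNorm

/-- The basis `b` splits the norm `η`. -/
def Splits (η : SplitNorm F) (b : Module.Basis (Fin 2) F⸨X⸩ (Fin 2 → F⸨X⸩)) : Prop :=
  ∀ v, η.toFun v = max (absK (b.repr v 0) * η.toFun (b 0)) (absK (b.repr v 1) * η.toFun (b 1))

theorem ofBasis_apply (b : Module.Basis (Fin 2) F⸨X⸩ (Fin 2 → F⸨X⸩)) (a : Fin 2 → ℝ)
    (ha : ∀ i, 0 < a i) (i : Fin 2) : (ofBasis b a ha).toFun (b i) = a i := by
  fin_cases i <;> simp [ofBasis, absK_one, absK_zero, (ha 0).le, (ha 1).le]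

theorem ofBasis_splits (b : Module.Basis (Fin 2) F⸨X⸩ (Fin 2 → F⸨X⸩)) (a : Fin 2 → ℝ)
    (ha : ∀ i, 0 < a i) : (ofBasis b a ha).Splits b := fun v => by
  rw [ofBasis_apply, ofBasis_apply]; rfl

theorem Splits.eq_max {η : SplitNorm F} {b : Module.Basis (Fin 2) F⸨X⸩ (Fin 2 → F⸨X⸩)}
    (hb : η.Splits b) {i j : Fin 2} (hij : i ≠ j) (v) :
    η.toFun v = max (absK (b.repr v i) * η.toFun (b i)) (absK (b.repr v j) * η.toFun (b j)) := by
  rw [hb v]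
  fin_cases i <;> fin_cases j <;> first | exact absurd rfl hij | rfl | exact max_comm _ _

theorem repr_add_repr (b : Module.Basis (Fin 2) F⸨X⸩ (Fin 2 → F⸨X⸩)) {i j : Fin 2} (hij : i ≠ j)
    (v) : b.repr v i • b i + b.repr v j • b j = v := by
  conv_rhs => rw [← b.sum_repr v, Fin.sum_univ_two]
  fin_cases i <;> fin_cases j <;> first | exact absurd rfl hij | rfl | exact add_comm _ _

theorem Splits.le_mul {η θ : SplitNorm F} {b : Module.Basis (Fin 2) F⸨X⸩ (Fin 2 → F⸨X⸩)}
    (hb : η.Splits b) {C : ℝ} (hC : 0 ≤ C) (h : ∀ i, θ.toFun (b i) ≤ C * η.toFun (b i)) (v) :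
    θ.toFun v ≤ C * η.toFun v := by
  rw [hb v, mul_max_of_nonneg _ _ hC]
  conv_lhs => rw [← b.sum_repr v, Fin.sum_univ_two]
  refine (θ.add_le _ _).trans (max_le_max ?_ ?_) <;> rw [θ.map_smul, mul_left_comm] <;>
    exact mul_le_mul_of_nonneg_left (h _) (absK_nonneg _)

/-- Each inequality need only be tested on the basis splitting its larger side. Two bases are
allowed so that the comparison also covers bases spanning the same lines in the opposite order. -/
theorem Splits.eq_mul {η θ : SplitNorm F} {b b' : Module.Basis (Fin 2) F⸨X⸩ (Fin 2 → F⸨X⸩)}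
    (hb : η.Splits b) (hb' : θ.Splits b') {c : ℝ} (hc : 0 < c)
    (h : ∀ i, η.toFun (b i) = c * θ.toFun (b i)) (h' : ∀ i, η.toFun (b' i) = c * θ.toFun (b' i))
    (v) : η.toFun v = c * θ.toFun v := by
  refine le_antisymm (hb'.le_mul hc.le (fun i => (h' i).le) v) ?_
  have := hb.le_mul (θ := θ) (inv_nonneg.2 hc.le) (fun i => by
    rw [h i, inv_mul_cancel_left₀ hc.ne']) v
  calc c * θ.toFun v ≤ c * (c⁻¹ * η.toFun v) := mul_le_mul_of_nonneg_left this hc.le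
    _ = η.toFun v := mul_inv_cancel_left₀ hc.ne' _

theorem exists_le_mul (η θ : SplitNorm F) : ∃ C, 0 ≤ C ∧ (∀ v, θ.toFun v ≤ C * η.toFun v) ∧
    ∃ v ≠ 0, θ.toFun v = C * η.toFun v := by
  obtain ⟨b, hb⟩ := η.exists_splitting
  have hpos := fun i => η.pos (b.ne_zero i)
  obtain ⟨i, hi⟩ := Finite.exists_max fun i => θ.toFun (b i) / η.toFun (b i)
  have h0 : 0 ≤ θ.toFun (b i) / η.toFun (b i) := div_nonneg (θ.nonneg _) (η.nonneg _)
  exact ⟨_, h0, Splits.le_mul hb h0 fun j => (div_le_iff₀ (hpos j)).1 (hi j), b i, b.ne_zero i,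
    (div_mul_cancel₀ _ (hpos i).ne').symm⟩

/-- The least constant `C` such that `θ ≤ C η`. -/
noncomputable def ratio (η θ : SplitNorm F) : ℝ := ⨆ v, θ.toFun v / η.toFun v

theorem ratio_le {η θ : SplitNorm F} {C : ℝ} (hC : 0 ≤ C) (h : ∀ v, θ.toFun v ≤ C * η.toFun v) :
    ratio η θ ≤ C := by
  refine ciSup_le fun v => ?_
  by_cases hv : v = 0
  · rw [hv, η.zero, div_zero]; exact hC
  · exact (div_le_iff₀ (η.pos hv)).2 (h v)

theorem le_ratio_mul (η θ : SplitNorm F) (v) : θ.toFun v ≤ ratio η θ * η.toFun v := by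
  obtain ⟨C, hC, h, -⟩ := exists_le_mul η θ
  by_cases hv : v = 0
  · rw [hv, η.zero, θ.zero, mul_zero]
  · refine (div_le_iff₀ (η.pos hv)).1 (le_ciSup (f := fun v => θ.toFun v / η.toFun v) ⟨C, ?_⟩ v)
    rintro _ ⟨w, rfl⟩
    by_cases hw : w = 0
    · simpa [hw, η.zero] using hC
    · exact (div_le_iff₀ (η.pos hw)).2 (h w)

theorem ratio_pos (η θ : SplitNorm F) : 0 < ratio η θ := by
  obtain ⟨v, hv⟩ := exists_ne (0 : Fin 2 → F⸨X⸩)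
  exact pos_of_mul_pos_left ((θ.pos hv).trans_le (le_ratio_mul η θ v)) (η.nonneg v)

theorem exists_eq_ratio_mul (η θ : SplitNorm F) : ∃ v ≠ 0, θ.toFun v = ratio η θ * η.toFun v := by
  obtain ⟨C, hC, h, v, hv, hv'⟩ := exists_le_mul η θ
  refine ⟨v, hv, le_antisymm (le_ratio_mul η θ v) ?_⟩
  rw [hv']
  exact mul_le_mul_of_nonneg_right (ratio_le hC h) (η.nonneg v)

theorem ratio_le_ratio_mul_ratio (η θ ζ : SplitNorm F) : ratio η ζ ≤ ratio η θ * ratio θ ζ := by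
  refine ratio_le (mul_nonneg (ratio_pos _ _).le (ratio_pos _ _).le) fun v => ?_
  refine (le_ratio_mul θ ζ v).trans ?_
  rw [mul_comm (ratio η θ), mul_assoc]
  exact mul_le_mul_of_nonneg_left (le_ratio_mul η θ v) (ratio_pos _ _).le

theorem add_eq_right (η : SplitNorm F) {v w} (h : η.toFun v < η.toFun w) :
    η.toFun (v + w) = η.toFun w := by
  refine le_antisymm ((η.add_le v w).trans (max_le h.le le_rfl)) ?_
  have h1 := η.add_le (v + w) ((-1 : F⸨X⸩) • v)
  rw [η.map_smul, absK_neg, absK_one, one_mul, neg_one_smul, add_neg_cancel_comm] at h1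
  exact (le_max_iff.1 h1).resolve_right (not_le.2 h)

end SplitNorm

open SplitNorm

theorem Tree.dist_mk (η θ : SplitNorm F) :
    Tree.dist (Quotient.mk (homothety F) η) (Quotient.mk (homothety F) θ) =
      Real.log (ratio η θ * ratio θ η) := rfl

theorem Tree.eq_of_dist_le_zero {x y : Tree F} (h : x.dist y ≤ 0) : x = y := by
  induction x using Quotient.inductionOn with | _ η
  induction y using Quotient.inductionOn with | _ θ
  rw [Tree.dist_mk, Real.log_nonpos_iff (mul_nonneg (ratio_pos _ _).le (ratio_pos _ _).le)] at h
  refine Quotient.sound ⟨ratio η θ, ratio_pos _ _, fun v => le_antisymm (le_ratio_mul η θ v) ?_⟩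
  refine (mul_le_mul_of_nonneg_left (le_ratio_mul θ η v) (ratio_pos _ _).le).trans ?_
  rw [← mul_assoc]
  exact mul_le_of_le_one_left (θ.nonneg v) h

/-- `θ / η` takes its maximum on the basis `b` only at `b j`; for `η` split by `b` this says
that the class of `θ` lies in the direction `j` as seen from the class of `η`. -/
def Leans (η θ : SplitNorm F) (b : Module.Basis (Fin 2) F⸨X⸩ (Fin 2 → F⸨X⸩)) (j : Fin 2) : Prop :=
  ∀ i ≠ j, θ.toFun (b i) * η.toFun (b j) < θ.toFun (b j) * η.toFun (b i)

/-- The ratio of the values of `η` on `b` is not in the value group. -/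
def Generic (η : SplitNorm F) (b : Module.Basis (Fin 2) F⸨X⸩ (Fin 2 → F⸨X⸩)) : Prop :=
  ∀ i j, i ≠ j → ∀ l : ℤ, η.toFun (b i) ≠ Real.exp l * η.toFun (b j)

theorem Generic.mul_ne_mul {η : SplitNorm F} {b : Module.Basis (Fin 2) F⸨X⸩ (Fin 2 → F⸨X⸩)}
    (h : Generic η b) {i j : Fin 2} (hij : i ≠ j) {x y : F⸨X⸩} (hx : x ≠ 0) (hy : y ≠ 0) :
    absK x * η.toFun (b i) ≠ absK y * η.toFun (b j) := by
  intro he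
  rw [absK_of_ne hx, absK_of_ne hy] at he
  refine h i j hij (x.order - y.order) ?_
  rw [Int.cast_sub, sub_eq_add_neg, Real.exp_add, mul_assoc, ← he, ← mul_assoc, ← Real.exp_add]
  simp

/-- If the `j`-th term of `v` dominates for `η`, then it dominates even more for a norm leaning
towards `j`. -/
theorem Leans.le_apply {η θ : SplitNorm F} {b : Module.Basis (Fin 2) F⸨X⸩ (Fin 2 → F⸨X⸩)}
    {i j : Fin 2} (hij : i ≠ j) (h : Leans η θ b j) {v}
    (hv : absK (b.repr v i) * η.toFun (b i) < absK (b.repr v j) * η.toFun (b j)) :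
    θ.toFun v = absK (b.repr v j) * θ.toFun (b j) := by
  rw [← θ.map_smul]
  conv_lhs => rw [← repr_add_repr b hij v]
  refine θ.add_eq_right ?_
  rw [θ.map_smul, θ.map_smul]
  have hi := η.pos (b.ne_zero i)
  have hθ := θ.pos (b.ne_zero j)
  refine lt_of_mul_lt_mul_right ?_ (η.nonneg (b j))
  calc absK (b.repr v i) * θ.toFun (b i) * η.toFun (b j)
      = absK (b.repr v i) * (θ.toFun (b i) * η.toFun (b j)) := mul_assoc _ _ _
    _ ≤ absK (b.repr v i) * (θ.toFun (b j) * η.toFun (b i)) :=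
        mul_le_mul_of_nonneg_left (h i hij).le (absK_nonneg _)
    _ = θ.toFun (b j) * (absK (b.repr v i) * η.toFun (b i)) := by ring
    _ < θ.toFun (b j) * (absK (b.repr v j) * η.toFun (b j)) := mul_lt_mul_of_pos_left hv hθ
    _ = absK (b.repr v j) * θ.toFun (b j) * η.toFun (b j) := by ring

/-- This is the reverse of the multiplicative triangle inequality. On vectors dominated by `b j`,
`θ'` is the multiple `r η`, so there `η / θ` is `θ' / θ` divided by `r`. On vectors dominated by `b
i`, `η / θ` is constant, and its value at `b i` is smaller than that at `b j`. -/
theorem ratio_mul_ratio_le {η θ θ' : SplitNorm F}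
    {b : Module.Basis (Fin 2) F⸨X⸩ (Fin 2 → F⸨X⸩)} (hb : η.Splits b) (hgen : Generic η b)
    {i j : Fin 2} (hij : i ≠ j) (h : Leans η θ b i) (h' : Leans η θ' b j) :
    ratio θ η * ratio η θ' ≤ ratio θ θ' := by
  have hpi := η.pos (b.ne_zero i)
  have hpj := η.pos (b.ne_zero j)
  have hθj := θ.pos (b.ne_zero j)
  obtain ⟨r, hr⟩ : ∃ r, r = θ'.toFun (b j) / η.toFun (b j) := ⟨_, rfl⟩
  have hr0 : 0 < r := hr ▸ div_pos (θ'.pos (b.ne_zero j)) hpj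
  have hrj : θ'.toFun (b j) = r * η.toFun (b j) := by rw [hr, div_mul_cancel₀ _ hpj.ne']
  have hcases : ∀ l, l = i ∨ l = j := fun l => by omega
  have h1 : ratio η θ' ≤ r := by
    refine ratio_le hr0.le (hb.le_mul hr0.le fun l => ?_)
    rcases hcases l with rfl | rfl
    · refine le_of_mul_le_mul_right ((h' l hij).le.trans ?_) hpj
      rw [hrj]; exact le_of_eq (by ring)
    · exact hrj.le
  have hj : ∀ v, absK (b.repr v i) * η.toFun (b i) < absK (b.repr v j) * η.toFun (b j) →
      η.toFun v ≤ ratio θ θ' / r * θ.toFun v := by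
    intro v hv
    have e : θ'.toFun v = r * η.toFun v := by
      rw [h'.le_apply hij hv, hb.eq_max hij v, max_eq_right hv.le, hrj]; ring
    have := le_ratio_mul θ θ' v
    rw [e] at this
    rw [div_mul_eq_mul_div, le_div_iff₀ hr0, mul_comm]
    exact this
  have hi : η.toFun (b i) ≤ ratio θ θ' / r * θ.toFun (b i) := by
    have e := hj (b j) (by simp [hij, absK_zero, absK_one, hpj])
    have e2 := h j hij.symm
    refine le_of_mul_le_mul_left ?_ hθj
    calc θ.toFun (b j) * η.toFun (b i) ≤ θ.toFun (b i) * η.toFun (b j) := e2.le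
      _ ≤ θ.toFun (b i) * (ratio θ θ' / r * θ.toFun (b j)) :=
          mul_le_mul_of_nonneg_left e (θ.nonneg _)
      _ = _ := by ring
  have h2 : ratio θ η ≤ ratio θ θ' / r := by
    refine ratio_le (div_nonneg (ratio_pos _ _).le hr0.le) fun v => ?_
    rcases lt_trichotomy (absK (b.repr v i) * η.toFun (b i)) (absK (b.repr v j) * η.toFun (b j))
      with hv | hv | hv
    · exact hj v hv
    · have hv0 : v = 0 := by
        by_contra hne
        by_cases hxi : b.repr v i = 0
        · rw [hxi, absK_zero, zero_mul] at hv
          have hxj : b.repr v j = 0 :=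
            absK_eq_zero.1 ((mul_eq_zero.1 hv.symm).resolve_right hpj.ne')
          exact hne (by rw [← repr_add_repr b hij v, hxi, hxj]; simp)
        · by_cases hxj : b.repr v j = 0
          · rw [hxj, absK_zero, zero_mul] at hv
            exact hxi (absK_eq_zero.1 ((mul_eq_zero.1 hv).resolve_right hpi.ne'))
          · exact hgen.mul_ne_mul hij hxi hxj hv
      rw [hv0, η.zero, θ.zero, mul_zero]
    · rw [h.le_apply hij.symm hv, hb.eq_max hij v, max_eq_left hv.le, mul_left_comm]
      exact mul_le_mul_of_nonneg_left hi (absK_nonneg _)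
  calc ratio θ η * ratio η θ' ≤ ratio θ θ' / r * r :=
        mul_le_mul h2 h1 (ratio_pos _ _).le (div_nonneg (ratio_pos _ _).le hr0.le)
    _ = ratio θ θ' := div_mul_cancel₀ _ hr0.ne'

/-- A point in the interior of an edge separates its two sides. -/
theorem Tree.mem_geodesic_of_leans {η θ θ' : SplitNorm F}
    {b : Module.Basis (Fin 2) F⸨X⸩ (Fin 2 → F⸨X⸩)} (hb : η.Splits b) (hgen : Generic η b)
    {i j : Fin 2} (hij : i ≠ j) (h : Leans η θ b i) (h' : Leans η θ' b j) :
    (Quotient.mk (homothety F) η : Tree F) ∈ Tree.geodesic (Quotient.mk (homothety F) θ)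
      (Quotient.mk (homothety F) θ') := by
  have e1 : ratio θ θ' = ratio θ η * ratio η θ' :=
    le_antisymm (ratio_le_ratio_mul_ratio _ _ _) (ratio_mul_ratio_le hb hgen hij h h')
  have e2 : ratio θ' θ = ratio θ' η * ratio η θ :=
    le_antisymm (ratio_le_ratio_mul_ratio _ _ _) (ratio_mul_ratio_le hb hgen hij.symm h' h)
  change Tree.dist _ _ + Tree.dist _ _ = Tree.dist _ _
  have hp : ∀ η θ : SplitNorm F, ratio η θ ≠ 0 := fun η θ => (ratio_pos η θ).ne'
  rw [Tree.dist_mk, Tree.dist_mk, Tree.dist_mk, e1, e2, ← Real.log_mul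
    (mul_ne_zero (hp _ _) (hp _ _)) (mul_ne_zero (hp _ _) (hp _ _))]
  congr 1
  ring

theorem Lattice.exists_norm_eq_exp (M : Lattice F) {v : Fin 2 → F⸨X⸩} (hv : v ≠ 0) :
    ∃ l : ℤ, M.norm.toFun v = Real.exp l := by
  obtain ⟨b, hb⟩ := M.exists_basis
  have h0 : M.norm.toFun v = max (absK (b.repr v 0)) (absK (b.repr v 1)) :=
    (latticeFun_eq M.carrier b hb v).trans (by simp [SplitNorm.ofBasis])
  have hpos := M.norm.pos hv
  obtain ⟨x, hx⟩ : ∃ x : F⸨X⸩, M.norm.toFun v = absK x := by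
    rw [h0]
    rcases max_choice (absK (b.repr v 0)) (absK (b.repr v 1)) with h | h <;> exact ⟨_, h⟩
  have hx0 : x ≠ 0 := by
    rintro rfl
    rw [hx, absK_zero] at hpos
    exact lt_irrefl _ hpos
  exact ⟨-x.order, by rw [hx, absK_of_ne hx0]; simp⟩

theorem Generic.not_isVertex {η : SplitNorm F} {b : Module.Basis (Fin 2) F⸨X⸩ (Fin 2 → F⸨X⸩)}
    (h : Generic η b) : ¬ Tree.IsVertex (Quotient.mk (homothety F) η : Tree F) := by
  rintro ⟨M, hM⟩
  obtain ⟨c, hc, h'⟩ := Quotient.exact hM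
  obtain ⟨l, hl⟩ := M.exists_norm_eq_exp (b.ne_zero 0)
  obtain ⟨l', hl'⟩ := M.exists_norm_eq_exp (b.ne_zero 1)
  refine h 0 1 zero_ne_one (l - l') ?_
  rw [h', h', hl, hl', Int.cast_sub, Real.exp_sub]
  field_simp

/-- Lattice norms take values in `e ^ ℤ` on nonzero vectors, so a tie would put the ratio of the
values of `η` in the value group. -/
theorem Generic.exists_leans {η : SplitNorm F} {b : Module.Basis (Fin 2) F⸨X⸩ (Fin 2 → F⸨X⸩)}
    (h : Generic η b) (M : Lattice F) : ∃ j, Leans η M.norm b j := by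
  obtain ⟨l, hl⟩ := M.exists_norm_eq_exp (b.ne_zero 0)
  obtain ⟨l', hl'⟩ := M.exists_norm_eq_exp (b.ne_zero 1)
  have hne : M.norm.toFun (b 0) * η.toFun (b 1) ≠ M.norm.toFun (b 1) * η.toFun (b 0) := by
    rw [hl, hl']
    intro he
    refine h 0 1 zero_ne_one (l - l') ?_
    rw [Int.cast_sub, Real.exp_sub, div_mul_eq_mul_div, he, mul_div_cancel_left₀ _ (Real.exp_ne_zero _)]
  rcases hne.lt_or_gt with hlt | hlt
  · refine ⟨1, fun i hi => ?_⟩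
    obtain rfl : i = 0 := by omega
    exact hlt
  · refine ⟨0, fun i hi => ?_⟩
    obtain rfl : i = 1 := by omega
    exact hlt

end Norms

/-! ### Induced norms: expansion of distances and transport of sides. -/

section PushNorms

variable {F : Type*} [Field F] {p : ℕ} [Fact p.Prime]

open SplitNorm

theorem SplitNorm.Splits.push {η : SplitNorm F} {b b' : Module.Basis (Fin 2) F⸨X⸩ (Fin 2 → F⸨X⸩)}
    (hb : η.Splits b) {B : GL (Fin 2) F⸨X⸩}
    (hb' : ∀ i, b' i = semilin (expand F p) B.val (b i)) : (push p B η).Splits b' := by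
  have h := pushFun_eq _ η b b' hb' hb
  have h' : Kisin.push p B η = ofBasis b' (fun i => η.toFun (b i) ^ p)
      (fun i => pow_pos (η.pos (b.ne_zero i)) p) := SplitNorm.ext h
  rw [h']
  exact ofBasis_splits _ _ _

theorem push_apply (B : GL (Fin 2) F⸨X⸩) (η : SplitNorm F) (v) :
    (push p B η).toFun (semilin (expand F p) B.val v) = η.toFun v ^ p := by
  obtain ⟨b, hb⟩ := η.exists_splitting
  obtain ⟨b', hb'⟩ := exists_basis_semilin (p := p) B b
  refine (pushFun_eq _ η b b' hb' hb _).trans ?_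
  have h : semilin (expand F p) B.val v = ∑ i, expand F p (b.repr v i) • b' i := by
    conv_lhs => rw [← b.sum_repr v, map_sum]
    exact Finset.sum_congr rfl fun i _ => by rw [LinearMap.map_smulₛₗ, hb']
  have hr : ∀ i, b'.repr (semilin (expand F p) B.val v) i = expand F p (b.repr v i) := fun i => by
    rw [h]; exact congrFun (b'.repr_sum_self _) i
  simp only [ofBasis]
  rw [hr, hr, absK_expand, absK_expand, ← mul_pow, ← mul_pow, hb v]
  have h0 := mul_nonneg (absK_nonneg (b.repr v 0)) (η.nonneg (b 0))
  have h1 := mul_nonneg (absK_nonneg (b.repr v 1)) (η.nonneg (b 1))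
  rcases le_total (absK (b.repr v 0) * η.toFun (b 0)) (absK (b.repr v 1) * η.toFun (b 1))
    with h | h
  · rw [max_eq_right h, max_eq_right (pow_le_pow_left₀ h0 h p)]
  · rw [max_eq_left h, max_eq_left (pow_le_pow_left₀ h1 h p)]

/-- The supremum defining `ratio η θ` is attained at some `v`, and the image of `v` witnesses its
`p`-th power. -/
theorem ratio_pow_le_ratio_push (B : GL (Fin 2) F⸨X⸩) (η θ : SplitNorm F) :
    ratio η θ ^ p ≤ ratio (push p B η) (push p B θ) := by
  obtain ⟨v, hv, h⟩ := exists_eq_ratio_mul η θ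
  have h1 := le_ratio_mul (push p B η) (push p B θ) (semilin (expand F p) B.val v)
  rw [push_apply, push_apply, h, mul_pow] at h1
  exact le_of_mul_le_mul_right h1 (pow_pos (η.pos hv) p)

/-- The map of trees expands distances. -/
theorem mul_dist_le_dist_treeMap (B : GL (Fin 2) F⸨X⸩) (x y : Tree F) :
    p * x.dist y ≤ (treeMap p B x).dist (treeMap p B y) := by
  induction x using Quotient.inductionOn with | _ η
  induction y using Quotient.inductionOn with | _ θ
  have h1 := ratio_pos η θ
  have h2 := ratio_pos θ η
  change p * Real.log (ratio η θ * ratio θ η) ≤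
    Real.log (ratio (push p B η) (push p B θ) * ratio (push p B θ) (push p B η))
  rw [← Real.log_pow, mul_pow]
  exact Real.log_le_log (by positivity) (mul_le_mul (ratio_pow_le_ratio_push _ _ _)
    (ratio_pow_le_ratio_push _ _ _) (by positivity) (ratio_pos _ _).le)

/-- The defining inequality is homogeneous in each basis vector and in each norm, so it survives
`p`-th powers, the rescalings `x` and the homothety `c`. -/
theorem Leans.push {η η' θ : SplitNorm F} {b b' : Module.Basis (Fin 2) F⸨X⸩ (Fin 2 → F⸨X⸩)}
    {j : Fin 2} (h : Leans η θ b j) {B : GL (Fin 2) F⸨X⸩} {c : ℝ} (hc : 0 < c)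
    (hη : ∀ v, η'.toFun v = c * (push p B η).toFun v) (τ : Equiv.Perm (Fin 2))
    (hτ : ∀ i, ∃ x : F⸨X⸩, semilin (expand F p) B.val (b i) = x • b' (τ i)) :
    Leans η' (push p B θ) b' (τ j) := by
  intro i hi
  obtain ⟨i, rfl⟩ := τ.surjective i
  have hij : i ≠ j := fun e => hi (e ▸ rfl)
  obtain ⟨x, hx⟩ := hτ i
  obtain ⟨y, hy⟩ := hτ j
  have hθ := push_apply (p := p) B θ
  have hη' : ∀ v, η'.toFun (semilin (expand F p) B.val v) = c * η.toFun v ^ p := fun v => by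
    rw [hη, push_apply]
  have e1 := hθ (b i)
  have e2 := hθ (b j)
  have e3 := hη' (b i)
  have e4 := hη' (b j)
  rw [hx, SplitNorm.map_smul] at e1 e3
  rw [hy, SplitNorm.map_smul] at e2 e4
  have hlt := pow_lt_pow_left₀ (h i hij) (mul_nonneg (θ.nonneg _) (η.nonneg _))
    (Fact.out : p.Prime).ne_zero
  rw [mul_pow, mul_pow] at hlt
  have hlt' := mul_lt_mul_of_pos_left hlt hc
  refine lt_of_mul_lt_mul_left (a := absK x * absK y) ?_
    (mul_nonneg (absK_nonneg _) (absK_nonneg _))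
  calc _ = (absK x * (Kisin.push p B θ).toFun (b' (τ i))) * (absK y * η'.toFun (b' (τ j))) := by
        ring
    _ = c * (θ.toFun (b i) ^ p * η.toFun (b j) ^ p) := by rw [e1, e4]; ring
    _ < c * (θ.toFun (b j) ^ p * η.toFun (b i) ^ p) := hlt'
    _ = (absK y * (Kisin.push p B θ).toFun (b' (τ j))) * (absK x * η'.toFun (b' (τ i))) := by
        rw [e2, e3]; ring
    _ = _ := by ring

end PushNorms

end Kisin

namespace Kisin

/-! ### Composites of the semilinear maps along the cycle. -/

section Iterates

variable {F : Type*} [Field F] {p : ℕ} [Fact p.Prime]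

theorem expand_C (c : F) : expand F p (HahnSeries.C c) = HahnSeries.C c := by
  have hp : (p : ℤ) ≠ 0 := Nat.cast_ne_zero.2 (Fact.out : p.Prime).ne_zero
  ext g
  by_cases hg : ∃ m : ℤ, (p : ℤ) * m = g
  · obtain ⟨m, rfl⟩ := hg
    rw [coeff_expand_mul, HahnSeries.C_apply]
    by_cases hm : m = 0
    · rw [hm, mul_zero]
    · rw [HahnSeries.coeff_single_of_ne hm, HahnSeries.coeff_single_of_ne (mul_ne_zero hp hm)]
  · rw [coeff_expand_of_not p _ hg, HahnSeries.C_apply, HahnSeries.coeff_single_of_ne]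
    rintro rfl
    exact hg ⟨0, mul_zero _⟩

theorem expand_pow_C (n : ℕ) (c : F) : (expand F p ^ n) (HahnSeries.C c) = HahnSeries.C c := by
  induction n with
  | zero => rfl
  | succ n ih => rw [pow_succ', RingHom.mul_def, RingHom.comp_apply, ih, expand_C]

theorem absK_expand_pow (n : ℕ) (x : F⸨X⸩) : absK ((expand F p ^ n) x) = absK x ^ p ^ n := by
  induction n with
  | zero => simp
  | succ n ih => rw [pow_succ', RingHom.mul_def, RingHom.comp_apply, absK_expand, ih, ← pow_mul,
      pow_succ]

/-- The composite of the semilinear maps `v ↦ Bⱼ φ(v)`, `j = 1, …, m`. -/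
noncomputable def iterSemilin (p : ℕ) [Fact p.Prime] (B : ℕ → GL (Fin 2) F⸨X⸩) :
    ℕ → (Fin 2 → F⸨X⸩) → (Fin 2 → F⸨X⸩)
  | 0, v => v
  | m + 1, v => semilin (expand F p) (B (m + 1)).val (iterSemilin p B m v)

theorem exists_iterSemilin_eq (B : ℕ → GL (Fin 2) F⸨X⸩) (m : ℕ) :
    ∃ Ψ : (Fin 2 → F⸨X⸩) →ₛₗ[expand F p ^ m] (Fin 2 → F⸨X⸩), ∀ v, Ψ v = iterSemilin p B m v := by
  induction m with
  | zero =>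
    rw [show expand F p ^ 0 = RingHom.id _ from pow_zero _]
    exact ⟨LinearMap.id, fun _ => rfl⟩
  | succ m ih =>
    obtain ⟨Ψ, hΨ⟩ := ih
    have : RingHomCompTriple (expand F p ^ m) (expand F p) (expand F p ^ (m + 1)) :=
      ⟨(pow_succ' (expand F p) m).symm⟩
    refine ⟨(semilin (expand F p) (B (m + 1)).val).comp Ψ, fun v => ?_⟩
    rw [LinearMap.comp_apply, hΨ]
    rfl

theorem exists_basis_iterSemilin (B : ℕ → GL (Fin 2) F⸨X⸩)
    (b : Module.Basis (Fin 2) F⸨X⸩ (Fin 2 → F⸨X⸩)) (m : ℕ) :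
    ∃ b' : Module.Basis (Fin 2) F⸨X⸩ (Fin 2 → F⸨X⸩), ∀ i, b' i = iterSemilin p B m (b i) := by
  induction m with
  | zero => exact ⟨b, fun _ => rfl⟩
  | succ m ih =>
    obtain ⟨b₁, hb₁⟩ := ih
    obtain ⟨b₂, hb₂⟩ := exists_basis_semilin (p := p) (B (m + 1)) b₁
    exact ⟨b₂, fun i => by rw [hb₂, hb₁]; rfl⟩

end Iterates

/-! ### The fixed point in the product of trees. -/

section Product

variable {p : ℕ} [Fact p.Prime] {F k : Type*} [Field F] [Field k]
  [Algebra (ZMod p) F] [Algebra (ZMod p) k] [Finite k]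

/-- At an index where the distance between the two fixed points is greatest, the next factor would
show a distance at least `p` times as large; so the greatest distance is zero. -/
theorem phiBarA_fixedPoint_unique (A : GL (Fin 2) (F ⊗[ZMod p] k)⸨X⸩)
    (hpred : Function.Surjective (pred : (k →ₐ[ZMod p] F) → _))
    {P Q : (k →ₐ[ZMod p] F) → Tree F} (hP : phiBarA A P = P) (hQ : phiBarA A Q = Q) : Q = P := by
  ext1 j
  have : Nonempty (k →ₐ[ZMod p] F) := ⟨j⟩
  obtain ⟨i, hi⟩ := Finite.exists_max fun i => (Q i).dist (P i)
  refine Tree.eq_of_dist_le_zero ((hi j).trans ?_)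
  obtain ⟨l, rfl⟩ := hpred i
  have h1 := mul_dist_le_dist_treeMap (p := p) (comp A l) (Q (pred l)) (P (pred l))
  have h2 : (treeMap p (comp A l) (Q (pred l))).dist (treeMap p (comp A l) (P (pred l))) =
      (Q l).dist (P l) := congrArg₂ Tree.dist (congrFun hQ l) (congrFun hP l)
  rw [h2] at h1
  have h3 := h1.trans (hi l)
  have hp : (1 : ℝ) < p := by exact_mod_cast (Fact.out : p.Prime).one_lt
  by_contra hc
  have := mul_lt_mul_of_pos_right hp (not_le.1 hc)
  linarith

/-- If `Φ_A` permutes the lines spanned by bases adapted to generic norms whose classes are fixed,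
then simplicity gives the separation property of the fixed point. -/
theorem IsSimplePhi.exists_mem_geodesic {A : GL (Fin 2) (F ⊗[ZMod p] k)⸨X⸩} (hA : IsSimplePhi A)
    [Nonempty (k →ₐ[ZMod p] F)]
    (η : (k →ₐ[ZMod p] F) → SplitNorm F)
    (b : (k →ₐ[ZMod p] F) → Module.Basis (Fin 2) F⸨X⸩ (Fin 2 → F⸨X⸩))
    (hb : ∀ i, (η i).Splits (b i)) (hgen : ∀ i, Generic (η i) (b i))
    (hη : ∀ i, ∃ c, 0 < c ∧ ∀ v, (η i).toFun v = c * (push p (comp A i) (η (pred i))).toFun v)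
    (τ : (k →ₐ[ZMod p] F) → Equiv.Perm (Fin 2))
    (hτ : ∀ i j, ∃ x : F⸨X⸩, PhiComp A i (b (pred i) j) = x • b i (τ i j))
    (M : (k →ₐ[ZMod p] F) → Lattice F) :
    ∃ i, (Quotient.mk (homothety F) (η i) : Tree F) ∈
      Tree.geodesic (M i).toTree (phiBar A i (M (pred i)).toTree) := by
  choose D hD using fun i => (hgen i).exists_leans (M i)
  -- If the chosen sides matched everywhere, the lines spanned by `b i (D i)` would be a stable
  -- family.
  obtain ⟨i, hi⟩ : ∃ i, D i ≠ τ i (D (pred i)) := by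
    by_contra! hc
    obtain ⟨i₀⟩ := ‹Nonempty (k →ₐ[ZMod p] F)›
    refine hA.not_stable_lines (fun i => b i (D i)) ((b i₀).ne_zero _) fun i => ?_
    rw [hc i]
    exact hτ i _
  obtain ⟨c, hc, h⟩ := hη i
  exact ⟨i, Tree.mem_geodesic_of_leans (hb i) (hgen i) hi (hD i)
    ((hD (pred i)).push hc h (τ i) (hτ i))⟩

/-- The swapped lines of the full composite `Ψ` are carried along the cycle by the partial
composites. Only the step closing the cycle permutes the two lines, hence `τ` is a swap at position
`0` and trivial elsewhere. -/
theorem IsSimplePhi.exists_permuted_lines [IsAlgClosed F]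
    {A : GL (Fin 2) (F ⊗[ZMod p] k)⸨X⸩} (hA : IsSimplePhi A) :
    ∃ (η : (k →ₐ[ZMod p] F) → SplitNorm F)
      (b : (k →ₐ[ZMod p] F) → Module.Basis (Fin 2) F⸨X⸩ (Fin 2 → F⸨X⸩))
      (τ : (k →ₐ[ZMod p] F) → Equiv.Perm (Fin 2)),
      (∀ i, (η i).Splits (b i)) ∧ (∀ i, Generic (η i) (b i)) ∧
      (∀ i, ∃ c, 0 < c ∧ ∀ v, (η i).toFun v = c * (push p (comp A i) (η (pred i))).toFun v) ∧
      ∀ i j, ∃ x : F⸨X⸩, PhiComp A i (b (pred i) j) = x • b i (τ i j) := by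
  obtain ⟨n, s, m, hn, hsn, hs, hm, hms⟩ := exists_cycle (p := p) (F := F) (k := k)
  have hpred : ∀ i, s (m (pred i) + 1) = i ∧
      (m i = m (pred i) + 1 ∨ (m i = 0 ∧ m (pred i) + 1 = n)) := by
    intro i
    obtain ⟨hlt, hi⟩ := hm i
    rcases Nat.eq_zero_or_pos (m i) with h0 | h0
    · obtain ⟨n, rfl⟩ := Nat.exists_eq_succ_of_ne_zero hn
      have h1 : pred i = s n := by rw [← hs n, ← Nat.succ_eq_add_one, hsn, ← h0, hi]
      have h2 : m (pred i) = n := by rw [h1]; exact hms n n.lt_succ_self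
      rw [h2]
      exact ⟨by rw [← Nat.succ_eq_add_one, hsn, ← h0, hi], Or.inr ⟨h0, rfl⟩⟩
    · obtain ⟨j, hj⟩ := Nat.exists_eq_succ_of_ne_zero h0.ne'
      have h1 : pred i = s j := by rw [← hs j, ← Nat.succ_eq_add_one, ← hj, hi]
      have h2 : m (pred i) = j := by rw [h1]; exact hms j (by omega)
      rw [h2]
      exact ⟨by rw [← Nat.succ_eq_add_one, ← hj, hi], Or.inl hj⟩
  obtain ⟨it, hit⟩ : ∃ it, it = iterSemilin p fun j => comp A (s j) := ⟨_, rfl⟩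
  have hitS : ∀ i v, PhiComp A i (it (m (pred i)) v) = it (m (pred i) + 1) v := by
    intro i v
    conv_lhs => rw [← (hpred i).1]
    rw [(hpred i).1, hit]
    change _ = semilin (expand F p) (comp A (s (m (pred i) + 1))).val _
    rw [(hpred i).1]
    rfl
  have hit0 : ∀ v, it 0 v = v := fun v => by rw [hit]; rfl
  obtain ⟨Ψ, hΨ⟩ := exists_iterSemilin_eq (p := p) (fun j => comp A (s j)) n
  rw [← hit] at hΨ
  have hp2 : 2 ≤ p := (Fact.out : p.Prime).two_le
  have hm0 : m (s 0) = 0 := hms 0 (Nat.pos_of_ne_zero hn)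
  -- The partial images of an eigenvector of `Ψ` would span a stable family, which closes up at
  -- position `0` with factor `μ`.
  have hline : ∀ v ≠ 0, ∀ μ : F⸨X⸩, Ψ v ≠ μ • v := by
    intro v hv μ hμ
    refine hA.not_stable_lines (fun i => it (m i) v) (i₀ := s 0) (by rwa [hm0, hit0]) fun i => ?_
    rw [hitS]
    rcases (hpred i).2 with h | ⟨h, h'⟩
    · exact ⟨1, by rw [one_smul, h]⟩
    · exact ⟨μ, by rw [h, h', hit0, ← hΨ, hμ]⟩
  obtain ⟨e, l, hli, hl, hl0, hnd⟩ := exists_swapped_lines (q := p ^ n)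
    (hp2.trans (Nat.le_self_pow hn p)) (absK_expand_pow n) (expand_pow_C n) Ψ hline
  obtain ⟨b₀, hb₀⟩ : ∃ b₀ : Module.Basis (Fin 2) F⸨X⸩ (Fin 2 → F⸨X⸩), ⇑b₀ = ![e, Ψ e] :=
    ⟨basisOfLinearIndependentOfCardEqFinrank hli (by simp), by simp⟩
  choose b hb using exists_basis_iterSemilin (p := p) (fun j => comp A (s j)) b₀
  rw [← hit] at hb
  have hb00 : b 0 0 = e := by rw [hb, hit0, hb₀]; rfl
  have hb01 : b 0 1 = Ψ e := by rw [hb, hit0, hb₀]; rfl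
  have hbn0 : b n 0 = b 0 1 := by rw [hb, hb01, hb₀, ← hΨ]; rfl
  have hbn1 : b n 1 = l • b 0 0 := by rw [hb, hb00, hb₀, ← hΨ]; exact hl
  have hbS : ∀ i j, b (m (pred i) + 1) j = PhiComp A i (b (m (pred i)) j) := fun i j => by
    rw [hb, hb, hitS]
  -- Let the norm have values `exp t` on `e` and `1` on `Ψe`. One turn of the cycle gives `exp (t
  -- q)` on `Ψe` and `1` on `l e`, hence `exp (ord l)` on `e`. Proportionality to the original norm
  -- means `ord l - t q = t`.
  obtain ⟨t, ht⟩ : ∃ t : ℝ, t * ((p : ℝ) ^ n + 1) = l.order :=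
    ⟨l.order / ((p : ℝ) ^ n + 1), div_mul_cancel₀ _ (by positivity)⟩
  obtain ⟨a, ha0, ha1⟩ : ∃ a : Fin 2 → ℝ, a 0 = t ∧ a 1 = 0 := ⟨![t, 0], rfl, rfl⟩
  obtain ⟨η, hη, hηv⟩ : ∃ η : ℕ → SplitNorm F, (∀ j, (η j).Splits (b j)) ∧
      ∀ j i, (η j).toFun (b j i) = Real.exp (a i * p ^ j) :=
    ⟨fun j => SplitNorm.ofBasis (b j) (fun i => Real.exp (a i * p ^ j)) fun _ => Real.exp_pos _,
      fun j => SplitNorm.ofBasis_splits _ _ _, fun j i => SplitNorm.ofBasis_apply _ _ _ _⟩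
  have ht' : ∀ (j : ℕ) (r : ℤ), t * p ^ j ≠ r := by
    intro j r hr
    have h1 : ((p ^ n : ℕ) + 1 : ℤ) * r = p ^ j * l.order := by
      have : ((p : ℝ) ^ n + 1) * r = p ^ j * l.order := by rw [← ht, ← hr]; ring
      exact_mod_cast this
    -- An integral `t p ^ j` would make `q + 1` divide `p ^ j ord l`; as `q + 1` is prime to `p`, it
    -- would divide `ord l`.
    have hcop : IsCoprime (((p ^ n : ℕ) : ℤ) + 1) ((p : ℤ) ^ j) := by
      refine IsCoprime.pow_right ⟨1, -p ^ (n - 1), ?_⟩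
      push_cast
      rw [← pow_sub_one_mul hn (p : ℤ)]
      ring
    exact hnd (hcop.dvd_of_dvd_mul_left ⟨_, h1.symm⟩)
  have hgen : ∀ j, Generic (η j) (b j) := by
    intro j i i' hii' r hr
    rw [hηv, hηv, ← Real.exp_add, Real.exp_eq_exp] at hr
    obtain ⟨rfl, rfl⟩ | ⟨rfl, rfl⟩ : (i = 0 ∧ i' = 1) ∨ (i = 1 ∧ i' = 0) := by omega
    · rw [ha0, ha1] at hr
      exact ht' j r (by linarith)
    · rw [ha0, ha1] at hr
      exact ht' j (-r) (by push_cast; linarith)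
  have hpush : ∀ i j, (push p (comp A i) (η (m (pred i)))).toFun (b (m (pred i) + 1) j) =
      Real.exp (a j * p ^ (m (pred i) + 1)) := by
    intro i j
    rw [hbS]
    refine (push_apply _ _ _).trans ?_
    rw [hηv, ← Real.exp_nat_mul]
    ring_nf
  have hsplit : ∀ i, (push p (comp A i) (η (m (pred i)))).Splits (b (m (pred i) + 1)) :=
    fun i => (hη _).push (hbS i)
  refine ⟨fun i => η (m i), fun i => b (m i), fun i => if m i = 0 then Equiv.swap 0 1 else 1,
    fun i => hη _, fun i => hgen _, fun i => ?_, fun i j => ?_⟩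
  · rcases (hpred i).2 with h | ⟨h, h'⟩
    · refine ⟨1, one_pos, ?_⟩
      have hs' := hsplit i
      have hv := hpush i
      rw [← h] at hs' hv
      have : ∀ j, (η (m i)).toFun (b (m i) j) =
          1 * (push p (comp A i) (η (m (pred i)))).toFun (b (m i) j) := fun j => by
        rw [hv, hηv, one_mul]
      exact (hη (m i)).eq_mul hs' one_pos this this
    -- At the closing step the transported basis is `Ψe, l e` instead of `e, Ψe`; the constant is
    -- fixed by the value on `Ψe`, and the choice of `t` makes the value on `e` agree.
    · refine ⟨Real.exp (-(t * p ^ n)), Real.exp_pos _, ?_⟩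
      have hs' := hsplit i
      have hv := hpush i
      rw [h'] at hs' hv
      obtain ⟨θ, hθ⟩ : ∃ θ, θ = push p (comp A i) (η (m (pred i))) := ⟨_, rfl⟩
      simp only [← hθ] at hs' hv ⊢
      have hlabs : absK l = Real.exp (-l.order) := absK_of_ne hl0
      have hv0 : θ.toFun (b 0 1) = Real.exp (t * p ^ n) := by rw [← hbn0, hv, ha0]
      have hv1 : θ.toFun (b 0 0) = Real.exp l.order := by
        have h1 := hv 1
        rw [hbn1, θ.map_smul, hlabs, ha1, zero_mul, Real.exp_zero] at h1
        rw [← mul_right_inj' (Real.exp_ne_zero (-(l.order : ℝ))), h1, ← Real.exp_add]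
        simp
      have hη0 : (η 0).toFun (b 0 0) = Real.exp t := by rw [hηv, ha0]; simp
      have hη1 : (η 0).toFun (b 0 1) = 1 := by rw [hηv, ha1]; simp
      have c0 : (η 0).toFun (b 0 0) = Real.exp (-(t * p ^ n)) * θ.toFun (b 0 0) := by
        rw [hη0, hv1, ← Real.exp_add, ← ht]; ring_nf
      have c1 : (η 0).toFun (b 0 1) = Real.exp (-(t * p ^ n)) * θ.toFun (b 0 1) := by
        rw [hη1, hv0, ← Real.exp_add]; simp
      rw [h]
      refine (hη 0).eq_mul hs' (Real.exp_pos _) (fun j => ?_) (fun j => ?_)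
      · obtain rfl | rfl : j = 0 ∨ j = 1 := by omega
        · exact c0
        · exact c1
      · obtain rfl | rfl : j = 0 ∨ j = 1 := by omega
        · rw [hbn0]; exact c1
        · rw [hbn1, SplitNorm.map_smul, SplitNorm.map_smul, c0]; ring
  · simp only [← hbS]
    rcases (hpred i).2 with h | ⟨h, h'⟩
    · refine ⟨1, ?_⟩
      rw [if_neg (by omega), one_smul, h]
      rfl
    · rw [if_pos h, h', h]
      obtain rfl | rfl : j = 0 ∨ j = 1 := by omega
      · exact ⟨1, by rw [hbn0, one_smul, Equiv.swap_apply_left]⟩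
      · exact ⟨l, by rw [hbn1, Equiv.swap_apply_right]⟩

end Product

end Kisin

theorem mainTheorem3 {p : ℕ} [Fact p.Prime] {F k : Type*} [Field F] [Algebra (ZMod p) F]
    [IsAlgClosure (ZMod p) F] [Field k] [Finite k] [Algebra (ZMod p) k]
    (A : GL (Fin 2) (LaurentSeries (TensorProduct (ZMod p) F k))) (hA : Kisin.IsSimplePhi A) :
    ∃ P : (k →ₐ[ZMod p] F) → Kisin.Tree F,
      (Kisin.phiBarA A P = P ∧ ∀ Q, Kisin.phiBarA A Q = Q → Q = P) ∧
      (∀ i, ¬ (P i).IsVertex) ∧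
      ∀ M : (k →ₐ[ZMod p] F) → Kisin.Lattice F,
        ∃ i, P i ∈ Kisin.Tree.geodesic (M i).toTree
          (Kisin.phiBar A i (M (Kisin.pred i)).toTree) := by
  have : IsAlgClosed F := IsAlgClosure.isAlgClosed (ZMod p)
  obtain ⟨η, b, τ, hb, hgen, hη, hτ⟩ := hA.exists_permuted_lines
  obtain ⟨n, s, m, -, -, hs, hm, -⟩ := Kisin.exists_cycle (p := p) (F := F) (k := k)
  have : Nonempty (k →ₐ[ZMod p] F) := ⟨s 0⟩
  have hP : Kisin.phiBarA A (fun i => Quotient.mk (Kisin.homothety F) (η i)) =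
      fun i => Quotient.mk (Kisin.homothety F) (η i) := by
    ext1 i
    exact Quotient.sound (hη i)
  exact ⟨_, ⟨hP, fun Q hQ => Kisin.phiBarA_fixedPoint_unique A
    (fun i => ⟨s (m i + 1), by rw [hs, (hm i).2]⟩) hP hQ⟩, fun i => (hgen i).not_isVertex,
    hA.exists_mem_geodesic η b hb hgen hη τ hτ⟩
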